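/- **Conventions.** Graphs may have loops and parallel edges and have finitely many edges; $\vec E(G)$ is the set of oriented edges $(e,u,v)$, where $e$ is an edge with ends $u,v$ (a loop has one orientation). Let $\Gamma$ be a group, possibly infinite, with identity $1$. A $\Gamma$-gain function on $G$ is a map $\psi\colon\vec E(G)\to\Gamma$ with $\psi(e,u,v)=\psi(e,v,u)^{-1}$ whenever $u\neq v$. The gain of a walk is the product of the gains along it. A cycle is $\psi$-balanced if some simple closed walk around it has gain $1$, and unbalanced otherwise. For $\eta\colon V(G)\to\Gamma$ let $\psi^\eta(e,u,v)=\eta(u)^{-1}\psi(e,u,v)\eta(v)$; for $X\subseteq E(G)$ let $\psi(X)$ be the set of gains of all orientations of edges in $X$. A *theta graph* consists of three paths between two distinct vertices that share nothing else, pairwise. A *handcuff* consists of two edge-disjoint cycles with exactly one common vertex, or of two vertex-disjoint cycles with a minimal path connecting them. * The *frame matroid* $F(G,\psi)$ is the matroid on $E(G)$ whose circuits are the $\psi$-balanced cycles and the theta graphs and handcuffs all of whose cycles are unbalanced. * If $\mathcal C$ is a linear class of circuits of a matroid $N$, the *elementary lift of $N$ given by $\mathcal C$* is the matroid on the same ground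 set in which $X$ has rank $r_N(X)$ if every circuit of $N|X$ is in $\mathcal C$, and rank $r_N(X)+1$ otherwise. * The *lift matroid* $L(G,\psi)$ is the elementary lift of the graphic matroid $M(G)$ given by the set of $\psi$-balanced cycles. Let $\Gamma_1$ be a normal subgroup of $\Gamma$ and $\mathcal A$ a set of subgroups of $\Gamma$ such that every non-identity element of $\Gamma$ is in exactly one group in $\{\Gamma_1\}\cup\mathcal A$, and such that each $A\in\mathcal A$ is malnormal (for all $\gamma\in\Gamma- A$, $\gamma^{-1}A\gamma\cap A=\{1\}$) and has all its conjugates in $\mathcal A$. The partition $\{\Gamma_1\}\cup\mathcal A$ is *trivial* if it contains at most one nontrivial group. Let $\psi/\Gamma_1$ be the $(\Gamma/\Gamma_1)$-gain function induced by $\psi$, and let $\mathcal C(\Gamma,\Gamma_1,\mathcal A,G,\psi)$ be the set of circuits $C$ of $F(G,\psi/\Gamma_1)$ such that $C$ is a $\psi$-balanced cycle, or $C$ is a theta graph or handcuff and there are $\eta\colon V(G)\to\Gamma$ and $A\in\mathcal A$ with $\psi^\eta(C)\subseteq A$. Let $M(\Gamma,\Gamma_1,\mathcal A,G,\psi)$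 be the elementary lift of $F(G,\psi/\Gamma_1)$ given by $\mathcal C(\Gamma,\Gamma_1,\mathcal A,G,\psi)$. **Proposition.** Let $(G,\psi)$ be a $\Gamma$-gain graph. (a) If $\Gamma_1$ is trivial, and $\Gamma$ is finite or the partition $\{\Gamma_1\}\cup\mathcal A$ is trivial, then $M(\Gamma,\Gamma_1,\mathcal A,G,\psi)$ is well defined and equals the frame matroid $F(G,\psi)$. (b) If $\Gamma_1=\Gamma$, then $M(\Gamma,\Gamma_1,\mathcal A,G,\psi)$ is well defined and equals the lift matroid $L(G,\psi)$. -/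

import Mathlib

open scoped Graph

namespace GainGraph

/-! ### Group partitions -/

section Partitions

variable {Γ : Type*} [Group Γ]

/-- `A` is malnormal: for every `γ ∉ A`, the conjugate `γ⁻¹ A γ` meets `A` only in the identity. -/
def IsMalnormal (A : Subgroup Γ) : Prop :=
  ∀ γ : Γ, γ ∉ A → ∀ a ∈ A, γ⁻¹ * a * γ ∈ A → γ⁻¹ * a * γ = 1

/-- `{Γ₁} ∪ 𝒜` is a Frobenius partition of `Γ` (normality of `Γ₁` is a separate assumption). -/
structure IsFrobeniusPartition (Γ₁ : Subgroup Γ) (𝒜 : Set (Subgroup Γ)) : Prop where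
  /-- Every non-identity element is in exactly one group in `{Γ₁} ∪ 𝒜`. -/
  partition : ∀ γ : Γ, γ ≠ 1 → ∃! A : Subgroup Γ, A ∈ insert Γ₁ 𝒜 ∧ γ ∈ A
  malnormal : ∀ A ∈ 𝒜, IsMalnormal A
  conj_mem : ∀ A ∈ 𝒜, ∀ γ : Γ, A.map (MulAut.conj γ).toMonoidHom ∈ 𝒜

/-- The partition `{Γ₁} ∪ 𝒜` is trivial: it does not contain two different nontrivial groups. -/
def IsTrivialPartition (Γ₁ : Subgroup Γ) (𝒜 : Set (Subgroup Γ)) : Prop :=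
  ∀ A ∈ insert Γ₁ 𝒜, ∀ B ∈ insert Γ₁ 𝒜, A ≠ ⊥ → B ≠ ⊥ → A = B

end Partitions

/-! ### Walks, paths, cycles, theta graphs and handcuffs in a multigraph -/

section Graphs

variable {V β : Type*}

/-- An oriented edge `(e, u, v)`: an edge `e` with ends `u` and `v`.
A loop has one orientation, every other edge has two. -/
@[ext] structure OrientedEdge (G : Graph V β) where
  edge : β
  src : V
  tgt : V
  isLink : G.IsLink edge src tgt

/-- The oriented edge `(e, v, u)` obtained by reversing `(e, u, v)`. -/
def OrientedEdge.reverse {G : Graph V β} (d : OrientedEdge G) : OrientedEdge G :=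
  ⟨d.edge, d.tgt, d.src, d.isLink.symm⟩

variable (G : Graph V β)

/-- The list of oriented edges `W` is a walk from `u` to `v`. -/
def IsWalk : V → List (OrientedEdge G) → V → Prop
  | u, [], v => u = v
  | u, d :: W, v => d.src = u ∧ IsWalk d.tgt W v

/-- The set of edges that a walk traverses. -/
def edgesOf (W : List (OrientedEdge G)) : Set β := {e | e ∈ W.map OrientedEdge.edge}

/-- A walk from `u` to `v` without a repeated vertex. -/
def IsPath (u : V) (W : List (OrientedEdge G)) (v : V) : Prop :=
  IsWalk G u W v ∧ (u :: W.map OrientedEdge.tgt).Nodup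

/-- A nonempty closed walk that repeats no edge, and no vertex except that it ends where it
starts. A loop is such a walk of length one, two parallel edges form one of length two. -/
def IsSimpleClosedWalk (W : List (OrientedEdge G)) : Prop :=
  W ≠ [] ∧ (∃ u, IsWalk G u W u) ∧
    (W.map OrientedEdge.tgt).Nodup ∧ (W.map OrientedEdge.edge).Nodup

/-- `C` is (the edge set of) a cycle of `G`. -/
def IsCycle (C : Set β) : Prop := ∃ W, IsSimpleClosedWalk G W ∧ edgesOf G W = C

/-- The vertices incident with an edge in `X`. -/
def incidentVertices (X : Set β) : Set V := {v | ∃ e ∈ X, G.Inc e v}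

/-- `C` is the edge set of a theta graph: three paths between two distinct vertices `u` and `v`
that pairwise share no edge, and no vertex other than `u` and `v`. -/
def IsTheta (C : Set β) : Prop :=
  ∃ (u v : V) (P : Fin 3 → List (OrientedEdge G)), u ≠ v ∧
    (∀ i, IsPath G u (P i) v) ∧
    (∀ i j, i ≠ j → Disjoint (edgesOf G (P i)) (edgesOf G (P j))) ∧
    (∀ i j, i ≠ j → ∀ x, x ∈ u :: (P i).map OrientedEdge.tgt →
      x ∈ u :: (P j).map OrientedEdge.tgt → x = u ∨ x = v) ∧
    C = ⋃ i, edgesOf G (P i)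

/-- `C` is the edge set of a tight handcuff: two edge-disjoint cycles with exactly one common
vertex. -/
def IsTightHandcuff (C : Set β) : Prop :=
  ∃ D₁ D₂ : Set β, IsCycle G D₁ ∧ IsCycle G D₂ ∧ Disjoint D₁ D₂ ∧
    (∃ x, incidentVertices G D₁ ∩ incidentVertices G D₂ = {x}) ∧ C = D₁ ∪ D₂

/-- `C` is the edge set of a loose handcuff: two vertex-disjoint cycles with a minimal path
connecting them, that is, a path from a vertex `u` of the first to a vertex `v` of the second with
no other vertex on either of the cycles. -/
def IsLooseHandcuff (C : Set β) : Prop :=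
  ∃ (D₁ D₂ : Set β) (u v : V) (P : List (OrientedEdge G)), IsCycle G D₁ ∧ IsCycle G D₂ ∧
    Disjoint (incidentVertices G D₁) (incidentVertices G D₂) ∧ IsPath G u P v ∧
    (∀ x ∈ u :: P.map OrientedEdge.tgt,
      (x ∈ incidentVertices G D₁ ↔ x = u) ∧ (x ∈ incidentVertices G D₂ ↔ x = v)) ∧
    C = D₁ ∪ D₂ ∪ edgesOf G P

/-- `C` is the edge set of a theta graph or of a (tight or loose) handcuff. -/
def IsThetaOrHandcuff (C : Set β) : Prop :=
  IsTheta G C ∨ IsTightHandcuff G C ∨ IsLooseHandcuff G C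

end Graphs

/-! ### Gain functions -/

section Gains

variable {V β Γ : Type*} [Group Γ] {G : Graph V β}

/-- A `Γ`-gain function: reversing an edge that is not a loop inverts its gain. -/
structure GainFunction (G : Graph V β) (Γ : Type*) [Group Γ] where
  gain : OrientedEdge G → Γ
  gain_reverse : ∀ d : OrientedEdge G, d.src ≠ d.tgt → gain d = (gain d.reverse)⁻¹

namespace GainFunction

/-- The gain of a walk: the product of the gains along it. -/
def walkGain (ψ : GainFunction G Γ) (W : List (OrientedEdge G)) : Γ := (W.map ψ.gain).prod

/-- The set of (edge sets of) `ψ`-balanced cycles. -/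
def balancedCycles (ψ : GainFunction G Γ) : Set (Set β) :=
  {C | ∃ W, IsSimpleClosedWalk G W ∧ edgesOf G W = C ∧ ψ.walkGain W = 1}

/-- The gain function `ψ^η`, with `ψ^η(e, u, v) = η(u)⁻¹ ψ(e, u, v) η(v)`. -/
def switch (ψ : GainFunction G Γ) (η : V → Γ) : GainFunction G Γ where
  gain d := (η d.src)⁻¹ * ψ.gain d * η d.tgt
  gain_reverse d hd := by
    rw [ψ.gain_reverse d hd]
    simp [OrientedEdge.reverse, mul_assoc]

/-- The `(Γ ⧸ Γ₁)`-gain function induced by `ψ`. -/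
def quotient (ψ : GainFunction G Γ) (Γ₁ : Subgroup Γ) [Γ₁.Normal] :
    GainFunction G (Γ ⧸ Γ₁) where
  gain d := QuotientGroup.mk' Γ₁ (ψ.gain d)
  gain_reverse d hd := by rw [ψ.gain_reverse d hd, map_inv]

/-- `ψ(X)`: the set of gains of all orientations of the edges in `X`. -/
def gainsOf (ψ : GainFunction G Γ) (X : Set β) : Set Γ :=
  {γ | ∃ d : OrientedEdge G, d.edge ∈ X ∧ ψ.gain d = γ}

end GainFunction

end Gains

/-! ### The matroids

Each of the following predicates says which matroid on `E(G)` is meant, through its circuits or its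
rank function; at most one matroid satisfies it when `E(G)` is finite. -/

section Matroids

variable {V β Γ : Type*} [Group Γ] {G : Graph V β}

/-- The circuits of the frame matroid of the biased graph `(G, 𝓑)`: the balanced cycles, and the
theta graphs and handcuffs all of whose cycles are unbalanced. (The cycles of a handcuff are the two
from which it is built.) -/
def IsFrameCircuit (G : Graph V β) (𝓑 : Set (Set β)) (C : Set β) : Prop :=
  C ∈ 𝓑 ∨ (IsThetaOrHandcuff G C ∧ ∀ D ⊆ C, IsCycle G D → D ∉ 𝓑)

/-- `N` is the frame matroid `F(G, ψ)`. -/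
def IsFrameMatroid (ψ : GainFunction G Γ) (N : Matroid β) : Prop :=
  N.E = E(G) ∧ ∀ C, N.IsCircuit C ↔ IsFrameCircuit G ψ.balancedCycles C

/-- `N` is the graphic matroid `M(G)`. -/
def IsGraphicMatroid (G : Graph V β) (N : Matroid β) : Prop :=
  N.E = E(G) ∧ ∀ C, N.IsCircuit C ↔ IsCycle G C

/-- `M` is the elementary lift of `N` that corresponds to the linear class `𝒞` of circuits of `N`:
the rank of `X` in `M` is its rank in `N` if every circuit of `N` contained in `X` is in `𝒞`, and
larger by one otherwise. -/
def IsLiftBy (N : Matroid β) (𝒞 : Set (Set β)) (M : Matroid β) : Prop :=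
  M.E = N.E ∧ ∀ X ⊆ N.E,
    ((∀ C ⊆ X, N.IsCircuit C → C ∈ 𝒞) → M.eRk X = N.eRk X) ∧
    ((¬ ∀ C ⊆ X, N.IsCircuit C → C ∈ 𝒞) → M.eRk X = N.eRk X + 1)

/-- `M` is the lift matroid `L(G, ψ)`: the elementary lift of the graphic matroid that corresponds
to the linear class of `ψ`-balanced cycles. -/
def IsLiftMatroid (ψ : GainFunction G Γ) (M : Matroid β) : Prop :=
  ∃ N : Matroid β, IsGraphicMatroid G N ∧ IsLiftBy N ψ.balancedCycles M

/-- The linear class `𝒞(Γ, Γ₁, 𝒜, G, ψ)` of circuits of `F(G, ψ/Γ₁)`. -/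
def linearClass (Γ₁ : Subgroup Γ) [Γ₁.Normal] (𝒜 : Set (Subgroup Γ)) (ψ : GainFunction G Γ) :
    Set (Set β) :=
  {C | IsFrameCircuit G (ψ.quotient Γ₁).balancedCycles C ∧
    (C ∈ ψ.balancedCycles ∨
      (IsThetaOrHandcuff G C ∧
        ∃ η : V → Γ, ∃ A ∈ 𝒜, (ψ.switch η).gainsOf C ⊆ (A : Set Γ)))}

/-- `M` is the matroid `M(Γ, Γ₁, 𝒜, G, ψ)`: the elementary lift of the frame matroid `F(G, ψ/Γ₁)`
that corresponds to the linear class `𝒞(Γ, Γ₁, 𝒜, G, ψ)`. -/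
def IsGainMatroid (Γ₁ : Subgroup Γ) [Γ₁.Normal] (𝒜 : Set (Subgroup Γ)) (ψ : GainFunction G Γ)
    (M : Matroid β) : Prop :=
  ∃ N : Matroid β, IsFrameMatroid (ψ.quotient Γ₁) N ∧ IsLiftBy N (linearClass Γ₁ 𝒜 ψ) M

end Matroids

end GainGraph

/-! The identification of $M(\Gamma,\Gamma_1,\mathcal A,G,\psi)$ is short in both cases; most of the
work shows that the frame and lift matroids exist.

If $\Gamma_1$ is trivial, passing to $\psi/\Gamma_1$ does not change the balanced cycles, so the
lifted matroid is $F(G,\psi)$, and it suffices that the linear class contains all its circuits. For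
nontrivial $\Gamma$ this follows from $\Gamma\in\mathcal A$ (`IsFrobeniusPartition.top_mem`), with
$\eta=1$. For finite $\Gamma$ this is a count: the conjugates of a nontrivial malnormal $A$ contain
$|\Gamma|-[\Gamma:A]\ge|\Gamma|/2$ non-identity elements, so two conjugacy classes of such groups
cannot both fit beside the identity, and a single class can only fill $\Gamma$ if $[\Gamma:A]=1$.

If $\Gamma_1=\Gamma$, all cycles are balanced for $\psi/\Gamma_1$. Theta graphs and handcuffs
properly contain cycles, so the circuits are exactly the cycles, and a cycle is in the linear class
if and only if it is $\psi$-balanced.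

The frame matroid is built from a closure operator: an edge set spans gains between vertices by
composition and inversion, and it spans every gain between two unbalanced vertices. The exchange
property (`IsGainRel.exchange`) follows by testing spanning against explicit gain relations. A
dependent set contains a frame circuit (`exists_frameCircuit`), and every frame circuit is minimally
dependent (`IsFrameCircuit.spec`); together these determine the circuits.

The lift matroid comes from a modified closure operator, in which adjoining an element may not
destroy balance (`IsBalance.exists_lift`). For the graphic matroid, the balanced sets are those
admitting a potential (`hasPotential_iff`). -/

namespace GainGraph

/-! ### Matroids from closure operators -/

section Closure

variable {β : Type*}

/-- A closure operator with the Mac Lane–Steinitz exchange property. -/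
structure IsExchangeClosure (cl : Set β → Set β) : Prop where
  subset_cl : ∀ X, X ⊆ cl X
  cl_subset : ∀ {X Y}, X ⊆ cl Y → cl X ⊆ cl Y
  exchange : ∀ {X e f}, f ∈ cl (insert e X) → f ∉ cl X → e ∈ cl (insert f X)

/-- No element of `I` is in the closure of the others. -/
def ClIndep (cl : Set β → Set β) (I : Set β) : Prop := ∀ e ∈ I, e ∉ cl (I \ {e})

namespace IsExchangeClosure

variable {cl : Set β → Set β}

theorem mono (h : IsExchangeClosure cl) {X Y : Set β} (hXY : X ⊆ Y) : cl X ⊆ cl Y :=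
  h.cl_subset (hXY.trans (h.subset_cl Y))

theorem clIndep_subset (h : IsExchangeClosure cl) {I J : Set β} (hJ : ClIndep cl J) (hIJ : I ⊆ J) : ClIndep cl I :=
  fun e he hc => hJ e (hIJ he) (h.mono (Set.sdiff_subset_sdiff_left hIJ) hc)

theorem clIndep_insert (h : IsExchangeClosure cl) {I : Set β} {f : β} (hI : ClIndep cl I) (hf : f ∉ cl I) :
    ClIndep cl (insert f I) := by
  have hfI : f ∉ I := fun hm => hf (h.subset_cl I hm)
  rintro e (rfl | he) hc
  · rw [Set.insert_sdiff_self_of_notMem hfI] at hc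
    exact hf hc
  · have hne : f ≠ e := fun hfe => hfI (hfe ▸ he)
    rw [← Set.insert_sdiff_singleton_comm hne] at hc
    have := h.exchange hc (hI e he)
    rw [Set.insert_sdiff_singleton, Set.insert_eq_of_mem he] at this
    exact hf this

/-- Steinitz's argument: some `e ∈ J \ I` can be traded for an `f ∈ I` outside the closure of `J \
{e}`, which keeps the size and the independence of `J` and makes `J \ I` smaller. -/
theorem ncard_le_of_subset_cl (h : IsExchangeClosure cl) {I : Set β} (hI : I.Finite) :
    ∀ (n : ℕ) (J : Set β), J.Finite → (J \ I).ncard = n → ClIndep cl J → J ⊆ cl I →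
      J.ncard ≤ I.ncard := by
  intro n
  induction n with
  | zero =>
    intro J hJ hn _ _
    rw [Set.ncard_eq_zero (hJ.subset Set.sdiff_subset), Set.sdiff_eq_empty] at hn
    exact Set.ncard_le_ncard hn hI
  | succ n ih =>
    intro J hJ hn hJi hJI
    obtain ⟨e, heJ, heI⟩ : (J \ I).Nonempty := by
      rw [Set.nonempty_iff_ne_empty]
      rintro h0
      simp [h0] at hn
    have : ¬ I ⊆ cl (J \ {e}) := fun hs => hJi e heJ (h.cl_subset hs (hJI heJ))
    obtain ⟨f, hfI, hf⟩ := Set.not_subset.1 this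
    have hfJ : f ∉ J \ {e} := fun hm => hf (h.subset_cl _ hm)
    have hfin : (J \ {e}).Finite := hJ.subset Set.sdiff_subset
    have hc : (insert f (J \ {e})).ncard = J.ncard := by
      rw [Set.ncard_insert_of_notMem hfJ hfin, Set.ncard_sdiff_singleton_add_one heJ hJ]
    rw [← hc]
    refine ih _ (hfin.insert f) ?_ ?_ ?_
    · have hd : insert f (J \ {e}) \ I = (J \ I) \ {e} := by
        ext x
        simp only [Set.mem_sdiff, Set.mem_insert_iff, Set.mem_singleton_iff]
        constructor
        · rintro ⟨rfl | hx, hxI⟩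
          · exact absurd hfI hxI
          · exact ⟨⟨hx.1, hxI⟩, hx.2⟩
        · rintro ⟨⟨hx, hxI⟩, hxe⟩
          exact ⟨Or.inr ⟨hx, hxe⟩, hxI⟩
      have hm : e ∈ J \ I := ⟨heJ, heI⟩
      rw [hd, Set.ncard_sdiff_singleton_of_mem hm, hn]
      rfl
    · exact h.clIndep_insert (h.clIndep_subset hJi Set.sdiff_subset) hf
    · rintro x (rfl | hx)
      · exact h.subset_cl I hfI
      · exact hJI hx.1

theorem exists_matroid (h : IsExchangeClosure cl) {E : Set β} (hE : E.Finite) :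
    ∃ M : Matroid β, M.E = E ∧ ∀ I, M.Indep I ↔ I ⊆ E ∧ ClIndep cl I := by
  refine ⟨(IndepMatroid.ofFinite hE (fun I => I ⊆ E ∧ ClIndep cl I) ?_ ?_ ?_ ?_).matroid, rfl,
    fun I => Iff.rfl⟩
  · exact ⟨Set.empty_subset _, fun e he => absurd he (Set.notMem_empty e)⟩
  · exact fun I J hJ hIJ => ⟨hIJ.trans hJ.1, h.clIndep_subset hJ.2 hIJ⟩
  · rintro I J ⟨hIE, hI⟩ ⟨hJE, hJ⟩ hlt
    have : ¬ J ⊆ cl I := fun hs =>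
      absurd (h.ncard_le_of_subset_cl (hE.subset hIE) _ J (hE.subset hJE) rfl hJ hs) hlt.not_ge
    obtain ⟨e, heJ, he⟩ := Set.not_subset.1 this
    exact ⟨e, heJ, fun hm => he (h.subset_cl I hm), Set.insert_subset (hJE heJ) hIE,
      h.clIndep_insert hI he⟩
  · exact fun I hI => hI.1

/-- All sets `C \ {e}` span the same set. If `f` were redundant in `C \ {e}`, then `C \ {e, f}`
would span the larger independent set `C \ {e₀}`. Hence a circuit can be recognised from a single
independent deletion. -/
theorem clIndep_diff_singleton (h : IsExchangeClosure cl) {C : Set β} (hC : C.Finite) (hcl : ∀ e ∈ C, e ∈ cl (C \ {e}))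
    {e₀ : β} (he₀ : e₀ ∈ C) (hi : ClIndep cl (C \ {e₀})) {e : β} (he : e ∈ C) :
    ClIndep cl (C \ {e}) := by
  intro f hf hfc
  have h1 : C \ {e₀} ⊆ cl ((C \ {e}) \ {f}) := by
    have h2 : C \ {e} ⊆ cl ((C \ {e}) \ {f}) := by
      intro x hx
      by_cases hxf : x = f
      · rwa [hxf]
      · exact h.subset_cl _ ⟨hx, hxf⟩
    intro x hx
    by_cases hxe : x = e
    · rw [hxe]
      exact h.cl_subset h2 (hcl e he)
    · exact h2 ⟨hx.1, hxe⟩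
  have hfin : ((C \ {e}) \ {f}).Finite := hC.subset (Set.sdiff_subset.trans Set.sdiff_subset)
  have := h.ncard_le_of_subset_cl hfin _ _ (hC.subset Set.sdiff_subset) rfl hi h1
  rw [Set.ncard_sdiff_singleton_of_mem hf, Set.ncard_sdiff_singleton_of_mem he,
    Set.ncard_sdiff_singleton_of_mem he₀] at this
  have hpos : 0 < (C \ {e}).ncard :=
    (Set.ncard_pos (hC.subset Set.sdiff_subset)).2 ⟨f, hf⟩
  rw [Set.ncard_sdiff_singleton_of_mem he] at hpos
  omega

theorem isCircuit (h : IsExchangeClosure cl) {M : Matroid β} (hM : ∀ I, M.Indep I ↔ I ⊆ M.E ∧ ClIndep cl I) {C : Set β}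
    (hCE : C ⊆ M.E) (hC : C.Finite) (hcl : ∀ e ∈ C, e ∈ cl (C \ {e})) {e₀ : β} (he₀ : e₀ ∈ C)
    (hi : ClIndep cl (C \ {e₀})) : M.IsCircuit C := by
  rw [Matroid.isCircuit_iff_dep_forall_sdiff_singleton_indep]
  refine ⟨⟨fun hI => ((hM C).1 hI).2 e₀ he₀ (hcl e₀ he₀), hCE⟩, fun e he => ?_⟩
  exact (hM _).2 ⟨Set.sdiff_subset.trans hCE, h.clIndep_diff_singleton hC hcl he₀ hi he⟩

theorem _root_.GainGraph.exists_mem_cl_of_isCircuit {M : Matroid β}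
    (hM : ∀ I, M.Indep I ↔ I ⊆ M.E ∧ ClIndep cl I) {C : Set β} (hC : M.IsCircuit C) :
    ∃ e ∈ C, e ∈ cl (C \ {e}) := by
  by_contra! hn
  exact hC.not_indep ((hM C).2 ⟨hC.subset_ground, hn⟩)

theorem mem_closure_iff (h : IsExchangeClosure cl) {M : Matroid β} (hM : ∀ I, M.Indep I ↔ I ⊆ M.E ∧ ClIndep cl I)
    {I : Set β} (hI : M.Indep I) {e : β} (he : e ∈ M.E) : e ∈ M.closure I ↔ e ∈ cl I := by
  by_cases heI : e ∈ I
  · exact iff_of_true (M.mem_closure_of_mem heI hI.subset_ground) (h.subset_cl I heI)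
  constructor
  · intro hcl
    by_contra hn
    have hi : M.Indep (insert e I) := (hM _).2
      ⟨Set.insert_subset he hI.subset_ground, h.clIndep_insert ((hM I).1 hI).2 hn⟩
    exact (hI.mem_closure_iff_of_notMem heI).1 hcl |>.not_indep hi
  · intro hcl
    rw [hI.mem_closure_iff_of_notMem heI]
    refine ⟨fun hi => ?_, Set.insert_subset he hI.subset_ground⟩
    have := ((hM _).1 hi).2 e (Set.mem_insert e I)
    rw [Set.insert_sdiff_self_of_notMem heI] at this
    exact this hcl

end IsExchangeClosure

end Closure

/-! ### Finite groups that are partitioned by malnormal subgroups -/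

section Partitions

variable {Γ : Type*} [Group Γ]

/-- If two such products agree, the quotient of the two coset representatives conjugates a
non-identity element of `A` into `A`. By malnormality it lies in `A`, so the cosets agree. -/
theorem IsMalnormal.conj_injective {A : Subgroup Γ} (hA : IsMalnormal A) :
    Function.Injective
      (fun p : (Γ ⧸ A) × {a : A // a ≠ 1} => p.1.out * (p.2.1 : Γ) * p.1.out⁻¹) := by
  rintro ⟨q, ⟨a, ha⟩, ha1⟩ ⟨r, ⟨b, hb⟩, hb1⟩ hab
  simp only at hab
  have hb' : b ≠ 1 := fun h => hb1 (by ext; exact h)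
  have hqr : q = r := by
    by_contra hne
    have hn : (q.out⁻¹ * r.out) ∉ A := fun hm => hne (by
      rw [← QuotientGroup.eq] at hm
      simpa using hm)
    have hn' : (r.out⁻¹ * q.out) ∉ A := fun hm => hn (by simpa using A.inv_mem hm)
    have hc : (r.out⁻¹ * q.out)⁻¹ * b * (r.out⁻¹ * q.out) = a := by
      have : a = q.out⁻¹ * (q.out * a * q.out⁻¹) * q.out := by group
      rw [this, hab]
      group
    have := hA _ hn' b hb (hc ▸ ha)
    rw [hc] at this
    exact ha1 (by ext; exact this)
  subst hqr
  have : a = b := by simpa using hab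
  subst this
  rfl

theorem IsFrobeniusPartition.eq_of_mem {Γ₁ : Subgroup Γ} {𝒜 : Set (Subgroup Γ)}
    (h : IsFrobeniusPartition Γ₁ 𝒜) {A B : Subgroup Γ} (hA : A ∈ insert Γ₁ 𝒜)
    (hB : B ∈ insert Γ₁ 𝒜) {γ : Γ} (hγ : γ ≠ 1) (hγA : γ ∈ A) (hγB : γ ∈ B) : A = B :=
  (h.partition γ hγ).unique ⟨hA, hγA⟩ ⟨hB, hγB⟩

/-- The non-identity elements of the conjugates of `A`. -/
def conjugatesOf (A : Subgroup Γ) : Set Γ := {γ | γ ≠ 1 ∧ ∃ g : Γ, ∃ a ∈ A, γ = g * a * g⁻¹}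

theorem IsMalnormal.ncard_conjugatesOf [Finite Γ] {A : Subgroup Γ} (hA : IsMalnormal A) :
    (conjugatesOf A).ncard + A.index = Nat.card Γ := by
  have hr : conjugatesOf A = Set.range
      (fun p : (Γ ⧸ A) × {a : A // a ≠ 1} => p.1.out * (p.2.1 : Γ) * p.1.out⁻¹) := by
    ext γ
    constructor
    · rintro ⟨h1, g, a, ha, rfl⟩
      obtain ⟨x, hx⟩ := QuotientGroup.mk_out_eq_mul A g
      -- The chosen representative of the coset of `g` is `g * x`, so `a` has to be conjugated by `x
      -- ∈ A` to compensate.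
      refine ⟨((g : Γ ⧸ A), ⟨⟨(x : Γ)⁻¹ * a * x, A.mul_mem (A.mul_mem (A.inv_mem x.2) ha) x.2⟩,
        ?_⟩), ?_⟩
      · intro he
        have he' : (x : Γ)⁻¹ * a * x = 1 := congrArg Subtype.val he
        apply h1
        have : a = 1 := by
          have h2 : a = x * ((x : Γ)⁻¹ * a * x) * (x : Γ)⁻¹ := by group
          rw [h2, he']; group
        rw [this]; group
      · simp only [hx]
        group
    · rintro ⟨⟨q, ⟨a, ha⟩, ha1⟩, rfl⟩
      refine ⟨fun he => ha1 ?_, _, a, ha, rfl⟩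
      ext
      simpa using he
  have hc : Nat.card {a : A // a ≠ 1} + 1 = Nat.card A := by
    classical
    have := Fintype.ofFinite A
    rw [Nat.card_eq_fintype_card, Nat.card_eq_fintype_card, Fintype.card_subtype_compl,
      Fintype.card_subtype_eq]
    have : 0 < Fintype.card A := Fintype.card_pos
    omega
  rw [hr, ← Nat.card_coe_set_eq, Nat.card_range_of_injective hA.conj_injective, Nat.card_prod,
    ← A.index_mul_card, ← hc, Subgroup.index]
  ring

theorem two_mul_index_le [Finite Γ] {A : Subgroup Γ} (hA : A ≠ ⊥) :
    2 * A.index ≤ Nat.card Γ := by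
  rw [← A.index_mul_card, mul_comm]
  exact Nat.mul_le_mul_left _ (by rwa [← not_lt, Nat.lt_succ_iff, Subgroup.card_le_one_iff_eq_bot])

theorem IsFrobeniusPartition.conj_mem' {Γ₁ : Subgroup Γ} {𝒜 : Set (Subgroup Γ)}
    (h : IsFrobeniusPartition Γ₁ 𝒜) {A : Subgroup Γ} (hA : A ∈ 𝒜) {γ : Γ}
    (hγ : γ ∈ conjugatesOf A) : ∃ g : Γ, A.map (MulAut.conj g).toMonoidHom ∈ insert Γ₁ 𝒜 ∧
      γ ∈ A.map (MulAut.conj g).toMonoidHom := by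
  obtain ⟨-, g, a, ha, rfl⟩ := hγ
  exact ⟨g, Or.inr (h.conj_mem A hA g), a, ha, by simp⟩

theorem conjugatesOf_map (A : Subgroup Γ) (g : Γ) :
    conjugatesOf (A.map (MulAut.conj g).toMonoidHom) = conjugatesOf A := by
  ext γ
  constructor
  · rintro ⟨h1, x, _, ⟨a, ha, rfl⟩, rfl⟩
    exact ⟨h1, x * g, a, ha, by simp [mul_assoc]⟩
  · rintro ⟨h1, x, a, ha, rfl⟩
    exact ⟨h1, x * g⁻¹, g * a * g⁻¹, ⟨a, ha, by simp⟩, by group⟩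

/-- A common element lies in a conjugate of `A` and in a conjugate of `B`. Both are parts of the
partition, so they coincide. -/
theorem IsFrobeniusPartition.conjugatesOf_eq {Γ₁ : Subgroup Γ} {𝒜 : Set (Subgroup Γ)}
    (h : IsFrobeniusPartition Γ₁ 𝒜) {A B : Subgroup Γ} (hA : A ∈ 𝒜) (hB : B ∈ 𝒜) {γ : Γ}
    (hγA : γ ∈ conjugatesOf A) (hγB : γ ∈ conjugatesOf B) : conjugatesOf A = conjugatesOf B := by
  obtain ⟨g, hg, hgγ⟩ := h.conj_mem' hA hγA
  obtain ⟨k, hk, hkγ⟩ := h.conj_mem' hB hγB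
  rw [← conjugatesOf_map A g, ← conjugatesOf_map B k, h.eq_of_mem hg hk hγA.1 hgγ hkγ]

theorem IsFrobeniusPartition.eq_top_of_finite [Finite Γ] {𝒜 : Set (Subgroup Γ)}
    (h : IsFrobeniusPartition ⊥ 𝒜) {A : Subgroup Γ} (hA : A ∈ 𝒜) (hAb : A ≠ ⊥) : A = ⊤ := by
  have hcA := (h.malnormal A hA).ncard_conjugatesOf
  have h2A := two_mul_index_le hAb
  have hall : ∀ γ : Γ, γ ≠ 1 → γ ∈ conjugatesOf A := by
    intro γ hγ
    by_contra hn
    obtain ⟨B, ⟨hB, hγB⟩, -⟩ := h.partition γ hγ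
    have hBb : B ≠ ⊥ := fun hb => hγ (by simpa [hb] using hγB)
    have hB' : B ∈ 𝒜 := hB.resolve_left hBb
    have hcB := (h.malnormal B hB').ncard_conjugatesOf
    have h2B := two_mul_index_le hBb
    have hγB' : γ ∈ conjugatesOf B := ⟨hγ, 1, γ, hγB, by simp⟩
    -- Two disjoint sets, each with at least half as many elements as `Γ`, leave no room for the
    -- identity.
    have hd : Disjoint (conjugatesOf A) (conjugatesOf B) := Set.disjoint_left.2 fun δ hδA hδB =>
      hn (h.conjugatesOf_eq hA hB' hδA hδB ▸ hγB')
    have h1 : (conjugatesOf A ∪ conjugatesOf B).ncard < Nat.card Γ := by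
      rw [← Set.ncard_univ]
      refine Set.ncard_lt_ncard ?_
      rw [Set.ssubset_univ_iff, Set.ne_univ_iff_exists_notMem]
      exact ⟨1, fun hm => hm.elim (fun hm => hm.1 rfl) fun hm => hm.1 rfl⟩
    rw [Set.ncard_union_eq hd] at h1
    omega
  have hle : Nat.card Γ ≤ (conjugatesOf A).ncard + 1 := by
    rw [← Set.ncard_univ]
    have : (Set.univ : Set Γ) ⊆ insert 1 (conjugatesOf A) := fun γ _ => by
      by_cases hγ : γ = 1
      · exact Or.inl hγ
      · exact Or.inr (hall γ hγ)
    exact (Set.ncard_le_ncard this).trans (Set.ncard_insert_le _ _)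
  exact Subgroup.index_eq_one.1 (le_antisymm (by omega)
    (Nat.one_le_iff_ne_zero.2 Subgroup.FiniteIndex.index_ne_zero))

theorem IsFrobeniusPartition.top_mem {𝒜 : Set (Subgroup Γ)} [Nontrivial Γ]
    (h : IsFrobeniusPartition ⊥ 𝒜) (h' : Finite Γ ∨ IsTrivialPartition ⊥ 𝒜) : ⊤ ∈ 𝒜 := by
  obtain ⟨γ, hγ⟩ := exists_ne (1 : Γ)
  obtain ⟨A, ⟨hA, hγA⟩, -⟩ := h.partition γ hγ
  have hAb : A ≠ ⊥ := fun hb => hγ (by simpa [hb] using hγA)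
  have hA' : A ∈ 𝒜 := hA.resolve_left hAb
  rcases h' with hf | ht
  · exact h.eq_top_of_finite hA' hAb ▸ hA'
  -- In a trivial partition, every non-identity element lies in the only nontrivial part.
  · have : A = ⊤ := by
      rw [eq_top_iff]
      intro δ _
      by_cases hδ : δ = 1
      · exact hδ ▸ A.one_mem
      obtain ⟨B, ⟨hB, hδB⟩, -⟩ := h.partition δ hδ
      have hBb : B ≠ ⊥ := fun hb => hδ (by simpa [hb] using hδB)
      rwa [ht A hA B hB hAb hBb]
    exact this ▸ hA'

end Partitions

/-! ### Gain relations and the frame closure -/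

section GainRelations

variable {V Γ : Type*} [Group Γ]

/-- A relation `R u v g` ("the gain `g` is spanned between `u` and `v`") that is closed under
composition and inversion, and in which all gains are spanned between unbalanced vertices. -/
structure IsGainRel (R : V → V → Γ → Prop) : Prop where
  refl : ∀ u, R u u 1
  symm : ∀ {u v g}, R u v g → R v u g⁻¹
  trans : ∀ {u v w g h}, R u v g → R v w h → R u w (g * h)
  full : ∀ {u v g h} (k : Γ), R u u g → g ≠ 1 → R v v h → h ≠ 1 → R u v k

/-- `u` is an unbalanced vertex of `R`. -/
def Unb (R : V → V → Γ → Prop) (u : V) : Prop := ∃ g, R u u g ∧ g ≠ 1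

/-- `u` and `v` are in the same component of `R`. -/
def Conn (R : V → V → Γ → Prop) (u v : V) : Prop := ∃ g, R u v g

namespace IsGainRel

variable {R : V → V → Γ → Prop}

theorem full' (h : IsGainRel R) {u v : V} (k : Γ) (hu : Unb R u) (hv : Unb R v) : R u v k := by
  obtain ⟨g, hg, hg1⟩ := hu
  obtain ⟨g', hg', hg1'⟩ := hv
  exact h.full k hg hg1 hg' hg1'

theorem unb_of_two (h : IsGainRel R) {u v : V} {g k : Γ} (hg : R u v g) (hk : R u v k)
    (hne : g ≠ k) : Unb R u :=
  ⟨g * k⁻¹, h.trans hg (h.symm hk), fun he => hne (mul_inv_eq_one.1 he)⟩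

theorem unb_of_conn (h : IsGainRel R) {u v : V} (hc : Conn R u v) (hv : Unb R v) : Unb R u := by
  obtain ⟨g, hg⟩ := hc
  obtain ⟨k, hk, hk1⟩ := hv
  refine ⟨g * k * g⁻¹, h.trans (h.trans hg hk) (h.symm hg), fun he => hk1 ?_⟩
  simpa using he

theorem conn_symm (h : IsGainRel R) {u v : V} (hc : Conn R u v) : Conn R v u :=
  let ⟨_, hg⟩ := hc; ⟨_, h.symm hg⟩

theorem conn_trans (h : IsGainRel R) {u v w : V} (hc : Conn R u v) (hc' : Conn R v w) :
    Conn R u w :=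
  let ⟨_, hg⟩ := hc; let ⟨_, hg'⟩ := hc'; ⟨_, h.trans hg hg'⟩

/-- Spanning all gains between the vertices of a set `U` that is a union of components and
contains the unbalanced vertices. -/
theorem sup_full (h : IsGainRel R) {U : V → Prop} (hU : ∀ u, Unb R u → U u)
    (hUc : ∀ u v, Conn R u v → U v → U u) : IsGainRel fun u v k => R u v k ∨ (U u ∧ U v) where
  refl u := Or.inl (h.refl u)
  symm := by
    rintro u v g (hg | ⟨hu, hv⟩)
    · exact Or.inl (h.symm hg)
    · exact Or.inr ⟨hv, hu⟩
  trans := by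
    rintro u v w g k (hg | ⟨hu, hv⟩) (hk | ⟨hv', hw⟩)
    · exact Or.inl (h.trans hg hk)
    · exact Or.inr ⟨hUc _ _ ⟨g, hg⟩ hv', hw⟩
    · exact Or.inr ⟨hu, hUc _ _ ⟨_, h.symm hk⟩ hv⟩
    · exact Or.inr ⟨hu, hw⟩
  full := by
    rintro u v g k l hg hg1 hk hk1
    refine Or.inr ⟨?_, ?_⟩
    · exact hg.elim (fun hg => hU u ⟨g, hg, hg1⟩) And.left
    · exact hk.elim (fun hk => hU v ⟨k, hk, hk1⟩) And.left

/-- Merging two balanced components along an edge of gain `g` from `a` to `b`. -/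
theorem sup_merge (h : IsGainRel R) {a b : V} {g : Γ} (hab : ¬ Conn R a b) (ha : ¬ Unb R a)
    (hb : ¬ Unb R b) : IsGainRel fun u v k => R u v k ∨
      (∃ x y, R u a x ∧ R b v y ∧ k = x * g * y) ∨
      (∃ x y, R u b x ∧ R a v y ∧ k = x * g⁻¹ * y) := by
  -- A composition through the new edge either connects `a` to `b` in `R`, which is excluded, or
  -- crosses the edge back and forth around a closed gain at `a` or `b`, which is trivial by
  -- balance.
  have hA : ∀ {x y v}, R a v x → R v a y → x * y = 1 := fun hx hy => by
    by_contra hn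
    exact ha ⟨_, h.trans hx hy, hn⟩
  have hB : ∀ {x y v}, R b v x → R v b y → x * y = 1 := fun hx hy => by
    by_contra hn
    exact hb ⟨_, h.trans hx hy, hn⟩
  have hAB : ∀ {x y v}, R a v x → R v b y → False := fun hx hy => hab ⟨_, h.trans hx hy⟩
  have hBA : ∀ {x y v}, R b v x → R v a y → False :=
    fun hx hy => hab ⟨_, h.symm (h.trans hx hy)⟩
  refine ⟨fun u => Or.inl (h.refl u), ?_, ?_, ?_⟩
  · rintro u v k (hk | ⟨x, y, hx, hy, rfl⟩ | ⟨x, y, hx, hy, rfl⟩)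
    · exact Or.inl (h.symm hk)
    · exact Or.inr (Or.inr ⟨_, _, h.symm hy, h.symm hx, by group⟩)
    · exact Or.inr (Or.inl ⟨_, _, h.symm hy, h.symm hx, by group⟩)
  · rintro u v w k l (hk | ⟨x, y, hx, hy, rfl⟩ | ⟨x, y, hx, hy, rfl⟩)
      (hl | ⟨z, t, hz, ht, rfl⟩ | ⟨z, t, hz, ht, rfl⟩)
    · exact Or.inl (h.trans hk hl)
    · exact Or.inr (Or.inl ⟨_, _, h.trans hk hz, ht, by group⟩)
    · exact Or.inr (Or.inr ⟨_, _, h.trans hk hz, ht, by group⟩)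
    · exact Or.inr (Or.inl ⟨_, _, hx, h.trans hy hl, by group⟩)
    · exact (hBA hy hz).elim
    · refine Or.inl ?_
      have : x * g * y * (z * g⁻¹ * t) = x * t := by
        rw [show x * g * y * (z * g⁻¹ * t) = x * g * (y * z) * g⁻¹ * t by group, hB hy hz]
        group
      exact this ▸ h.trans hx ht
    · exact Or.inr (Or.inr ⟨_, _, hx, h.trans hy hl, by group⟩)
    · refine Or.inl ?_
      have : x * g⁻¹ * y * (z * g * t) = x * t := by
        rw [show x * g⁻¹ * y * (z * g * t) = x * g⁻¹ * (y * z) * g * t by group, hA hy hz]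
        group
      exact this ▸ h.trans hx ht
    · exact (hAB hy hz).elim
  -- No vertex becomes unbalanced: a new closed gain at `u` would connect `u` to both `a` and `b` in
  -- `R`.
  · have key : ∀ {u k}, (R u u k ∨ (∃ x y, R u a x ∧ R b u y ∧ k = x * g * y) ∨
        (∃ x y, R u b x ∧ R a u y ∧ k = x * g⁻¹ * y)) → k ≠ 1 → Unb R u := by
      rintro u k (hk | ⟨x, y, hx, hy, rfl⟩ | ⟨x, y, hx, hy, rfl⟩) hk1
      · exact ⟨k, hk, hk1⟩
      · exact (hBA hy hx).elim
      · exact (hAB hy hx).elim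
    intro u v g' k l hg hg1 hk hk1
    exact Or.inl (h.full' l (key hg hg1) (key hk hk1))

/-- The exchange property for gain relations: if `S` contains `R` and the edge `f` from `c` to `d`,
and every gain relation that contains `R` and the edge from `a` to `b` spans `f`, while `R` does not
span `f`, then `S` spans the edge from `a` to `b`. -/
theorem exchange (h : IsGainRel R) {S : V → V → Γ → Prop} (hS : IsGainRel S)
    (hRS : ∀ {u v k}, R u v k → S u v k) {a b c d : V} {g f : Γ} (hf : ¬ R c d f) (hfS : S c d f)
    (hspan : ∀ R' : V → V → Γ → Prop, IsGainRel R' → (∀ {u v k}, R u v k → R' u v k) →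
      R' a b g → R' c d f) : S a b g := by
  by_cases hR : R a b g
  · exact hRS hR
  have hUS : ∀ {u}, Unb R u → Unb S u := fun ⟨k, hk, hk1⟩ => ⟨k, hRS hk, hk1⟩
  have hCS : ∀ {u v}, Conn R u v → Conn S u v := fun ⟨k, hk⟩ => ⟨k, hRS hk⟩
  -- Test `hspan` with the relation that declares the component of `p` unbalanced. Both ends of `f`
  -- must then lie in the enlarged unbalanced part, and at least one in the component of `p`. Hence
  -- `f` either links `p` to an unbalanced vertex or adds a second gain between two vertices of that
  -- component.
  have key : ∀ p, (Unb R a ∨ Conn R a p) → (Unb R b ∨ Conn R b p) → Unb S p := by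
    intro p hap hbp
    have hspan' := hspan (fun u v k => R u v k ∨
        ((Unb R u ∨ Conn R u p) ∧ (Unb R v ∨ Conn R v p)))
      (h.sup_full (fun u => Or.inl) fun u v huv hv => hv.imp (h.unb_of_conn huv)
        (h.conn_trans huv)) Or.inl (Or.inr ⟨hap, hbp⟩)
    rcases hspan'.resolve_left hf with ⟨hc | hc, hd | hd⟩
    · exact absurd (h.full' f hc hd) hf
    · exact hS.unb_of_conn (hS.conn_trans (hS.conn_symm (hCS hd)) (hS.conn_symm ⟨f, hfS⟩))
        (hUS hc)
    · exact hS.unb_of_conn (hS.conn_trans (hS.conn_symm (hCS hc)) ⟨f, hfS⟩) (hUS hd)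
    · refine hS.unb_of_conn (hS.conn_symm (hCS hc)) ?_
      obtain ⟨k, hk⟩ := h.conn_trans hc (h.conn_symm hd)
      exact hS.unb_of_two hfS (hRS hk) fun he => hf (he ▸ hk)
  by_cases hab : Conn R a b
  · have hb := key b (Or.inr hab) (Or.inr ⟨1, h.refl b⟩)
    exact hS.full' g (hS.unb_of_conn (hCS hab) hb) hb
  by_cases ha : Unb R a
  · exact hS.full' g (hUS ha) (key b (Or.inl ha) (Or.inr ⟨1, h.refl b⟩))
  by_cases hb : Unb R b
  · exact hS.full' g (key a (Or.inr ⟨1, h.refl a⟩) (Or.inl hb)) (hUS hb)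
  -- Two distinct balanced components remain. Here `f` must run parallel to the new edge, up to
  -- gains in `R`, and the formula for `f` can be solved for `g`.
  have := hspan _ (h.sup_merge (g := g) hab ha hb) Or.inl
    (Or.inr (Or.inl ⟨1, 1, h.refl a, h.refl b, by simp⟩))
  rcases this.resolve_left hf with ⟨x, y, hx, hy, rfl⟩ | ⟨x, y, hx, hy, rfl⟩
  · have := hS.trans (hS.trans (hS.symm (hRS hx)) hfS) (hS.symm (hRS hy))
    convert this using 1
    group
  · have := hS.trans (hS.trans (hRS hy) (hS.symm hfS)) (hRS hx)
    convert this using 1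
    group

end IsGainRel

end GainRelations

section FrameClosure

variable {V β Γ : Type*} [Group Γ] {G : Graph V β}

/-- The smallest gain relation that contains the edges in `X`. -/
inductive Span (ψ : GainFunction G Γ) (X : Set β) : V → V → Γ → Prop
  | refl (u : V) : Span ψ X u u 1
  | edge (d : OrientedEdge G) (hd : d.edge ∈ X) : Span ψ X d.src d.tgt (ψ.gain d)
  | symm {u v : V} {g : Γ} (h : Span ψ X u v g) : Span ψ X v u g⁻¹
  | trans {u v w : V} {g k : Γ} (h : Span ψ X u v g) (h' : Span ψ X v w k) : Span ψ X u w (g * k)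
  | full {u v : V} {g k : Γ} (l : Γ) (h : Span ψ X u u g) (hg : g ≠ 1) (h' : Span ψ X v v k)
      (hk : k ≠ 1) : Span ψ X u v l

theorem isGainRel_span (ψ : GainFunction G Γ) (X : Set β) : IsGainRel (Span ψ X) :=
  ⟨Span.refl, Span.symm, Span.trans, Span.full⟩

theorem Span.least {ψ : GainFunction G Γ} {X : Set β} {R : V → V → Γ → Prop} (hR : IsGainRel R)
    (hX : ∀ d : OrientedEdge G, d.edge ∈ X → R d.src d.tgt (ψ.gain d)) {u v : V} {g : Γ}
    (h : Span ψ X u v g) : R u v g := by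
  induction h with
  | refl u => exact hR.refl u
  | edge d hd => exact hX d hd
  | symm _ ih => exact hR.symm ih
  | trans _ _ ih ih' => exact hR.trans ih ih'
  | full l _ hg _ hk ih ih' => exact hR.full l ih hg ih' hk

theorem Span.mono {ψ : GainFunction G Γ} {X Y : Set β} (hXY : X ⊆ Y) {u v : V} {g : Γ}
    (h : Span ψ X u v g) : Span ψ Y u v g :=
  h.least (isGainRel_span ψ Y) fun d hd => .edge d (hXY hd)

/-- The edges spanned by `X` in the frame matroid. -/
def frameCl (ψ : GainFunction G Γ) (X : Set β) : Set β :=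
  {e | ∀ d : OrientedEdge G, d.edge = e → Span ψ X d.src d.tgt (ψ.gain d)}

theorem OrientedEdge.eq_or_eq_reverse {d d' : OrientedEdge G} (h : d.edge = d'.edge) :
    d' = d ∨ d' = d.reverse := by
  have hl := d'.isLink
  rw [← h] at hl
  rcases d.isLink.eq_and_eq_or_eq_and_eq hl with ⟨h1, h2⟩ | ⟨h1, h2⟩
  · exact Or.inl (OrientedEdge.ext h.symm h1.symm h2.symm)
  · exact Or.inr (OrientedEdge.ext h.symm h2.symm h1.symm)

theorem GainFunction.rel_of_rel {ψ : GainFunction G Γ} {R : V → V → Γ → Prop} (hR : IsGainRel R)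
    {d d' : OrientedEdge G} (h : d.edge = d'.edge) (hd : R d.src d.tgt (ψ.gain d)) :
    R d'.src d'.tgt (ψ.gain d') := by
  rcases OrientedEdge.eq_or_eq_reverse h with rfl | rfl
  · exact hd
  -- A loop is its own reverse, and its gain need not be an involution.
  · by_cases hl : d.src = d.tgt
    · have : d.reverse = d := OrientedEdge.ext rfl hl.symm hl
      rwa [this]
    · have := hR.symm hd
      rwa [ψ.gain_reverse d hl, inv_inv] at this

theorem mem_frameCl_iff {ψ : GainFunction G Γ} {X : Set β} (d : OrientedEdge G) :
    d.edge ∈ frameCl ψ X ↔ Span ψ X d.src d.tgt (ψ.gain d) :=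
  ⟨fun h => h d rfl, fun h _ hd' => GainFunction.rel_of_rel (isGainRel_span ψ X) hd'.symm h⟩

theorem isExchangeClosure_frameCl (ψ : GainFunction G Γ) : IsExchangeClosure (frameCl ψ) where
  subset_cl X e he d hd := .edge d (hd ▸ he)
  cl_subset {X Y} hXY e he d hd := (he d hd).least (isGainRel_span ψ Y) fun d' hd' => hXY hd' d' rfl
  exchange {X e f} hf hfX := by
    intro d hd
    have : ∃ d' : OrientedEdge G, d'.edge = f ∧ ¬ Span ψ X d'.src d'.tgt (ψ.gain d') := by
      by_contra! hn
      exact hfX hn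
    obtain ⟨d', hd', hn⟩ := this
    refine (isGainRel_span ψ X).exchange (isGainRel_span ψ _)
      (Span.mono (Set.subset_insert f X)) hn
      (.edge d' (hd' ▸ Set.mem_insert _ _)) fun R hR hXR hdR => ?_
    refine (hf d' hd').least hR ?_
    rintro c (hc | hc)
    · exact GainFunction.rel_of_rel hR (hd.trans hc.symm) hdR
    · exact hXR (.edge c hc)

end FrameClosure

/-! ### Walks, paths and cycles -/

section Walks

variable {V β : Type*} {G : Graph V β}

theorem mem_edgesOf {W : List (OrientedEdge G)} {e : β} :
    e ∈ edgesOf G W ↔ ∃ d ∈ W, d.edge = e := by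
  simp [edgesOf]

@[simp] theorem edgesOf_nil : edgesOf G [] = ∅ := by ext; simp [edgesOf]

@[simp] theorem edgesOf_cons (d : OrientedEdge G) (W : List (OrientedEdge G)) :
    edgesOf G (d :: W) = insert d.edge (edgesOf G W) := by
  ext e; simp [mem_edgesOf, eq_comm]

@[simp] theorem edgesOf_append (W W' : List (OrientedEdge G)) :
    edgesOf G (W ++ W') = edgesOf G W ∪ edgesOf G W' := by
  ext e; simp [mem_edgesOf, or_and_right, exists_or]

theorem edgesOf_subset_edgeSet (W : List (OrientedEdge G)) : edgesOf G W ⊆ E(G) := by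
  intro e he
  obtain ⟨d, -, rfl⟩ := mem_edgesOf.1 he
  exact d.isLink.edge_mem

@[simp] theorem isWalk_nil {u v : V} : IsWalk G u [] v ↔ u = v := Iff.rfl

@[simp] theorem isWalk_cons {u v : V} {d : OrientedEdge G} {W : List (OrientedEdge G)} :
    IsWalk G u (d :: W) v ↔ d.src = u ∧ IsWalk G d.tgt W v := Iff.rfl

theorem isWalk_append {u v : V} {W W' : List (OrientedEdge G)} :
    IsWalk G u (W ++ W') v ↔ ∃ x, IsWalk G u W x ∧ IsWalk G x W' v := by
  induction W generalizing u with
  | nil => simp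
  | cons d W ih => simp [ih, and_assoc]

theorem IsWalk.end_mem {u v : V} {W : List (OrientedEdge G)} (h : IsWalk G u W v) :
    v ∈ u :: W.map OrientedEdge.tgt := by
  induction W generalizing u with
  | nil => simp [isWalk_nil.1 h]
  | cons d W ih => exact List.mem_cons_of_mem _ (ih h.2)

theorem IsWalk.end_mem_tgt {u v : V} {W : List (OrientedEdge G)} (h : IsWalk G u W v)
    (hW : W ≠ []) : v ∈ W.map OrientedEdge.tgt := by
  cases W with
  | nil => exact absurd rfl hW
  | cons d W => exact h.2.end_mem

theorem IsWalk.src_mem {u v : V} {W : List (OrientedEdge G)} (h : IsWalk G u W v)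
    {d : OrientedEdge G} (hd : d ∈ W) : d.src ∈ u :: W.map OrientedEdge.tgt := by
  induction W generalizing u with
  | nil => simp at hd
  | cons c W ih =>
    rcases List.mem_cons.1 hd with rfl | hd
    · rw [h.1]; exact List.mem_cons_self
    · exact List.mem_cons_of_mem _ (ih h.2 hd)

theorem IsWalk.split {u v x : V} {W : List (OrientedEdge G)} (h : IsWalk G u W v)
    (hx : x ∈ u :: W.map OrientedEdge.tgt) :
    ∃ W₁ W₂, W = W₁ ++ W₂ ∧ IsWalk G u W₁ x ∧ IsWalk G x W₂ v := by
  induction W generalizing u with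
  | nil =>
    obtain rfl : x = u := by simpa using hx
    exact ⟨[], [], rfl, rfl, h⟩
  | cons d W ih =>
    rcases List.mem_cons.1 hx with rfl | hx
    · exact ⟨[], d :: W, rfl, rfl, h⟩
    · obtain ⟨W₁, W₂, rfl, h1, h2⟩ := ih h.2 hx
      exact ⟨d :: W₁, W₂, rfl, ⟨h.1, h1⟩, h2⟩

theorem mem_incidentVertices_of_edge {d : OrientedEdge G} {X : Set β} (hd : d.edge ∈ X) :
    d.src ∈ incidentVertices G X ∧ d.tgt ∈ incidentVertices G X :=
  ⟨⟨_, hd, d.isLink.inc_left⟩, ⟨_, hd, d.isLink.inc_right⟩⟩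

theorem incidentVertices_mono {X Y : Set β} (h : X ⊆ Y) :
    incidentVertices G X ⊆ incidentVertices G Y := fun _ ⟨e, he, hv⟩ => ⟨e, h he, hv⟩

theorem IsWalk.incidentVertices_subset {u v x : V} {W : List (OrientedEdge G)}
    (h : IsWalk G u W v) (hx : x ∈ incidentVertices G (edgesOf G W)) :
    x ∈ u :: W.map OrientedEdge.tgt := by
  obtain ⟨e, he, hv⟩ := hx
  obtain ⟨d, hd, rfl⟩ := mem_edgesOf.1 he
  rcases hv.eq_or_eq_of_isLink d.isLink with rfl | rfl
  · exact h.src_mem hd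
  · exact List.mem_cons_of_mem _ (List.mem_map_of_mem hd)

theorem mem_incidentVertices_of_mem_tgt {x : V} {W : List (OrientedEdge G)}
    (hx : x ∈ W.map OrientedEdge.tgt) : x ∈ incidentVertices G (edgesOf G W) := by
  obtain ⟨d, hd, rfl⟩ := List.mem_map.1 hx
  exact (mem_incidentVertices_of_edge (mem_edgesOf.2 ⟨d, hd, rfl⟩)).2

/-- The reversed walk. -/
def revWalk (W : List (OrientedEdge G)) : List (OrientedEdge G) :=
  (W.map OrientedEdge.reverse).reverse

@[simp] theorem revWalk_cons (d : OrientedEdge G) (W : List (OrientedEdge G)) :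
    revWalk (d :: W) = revWalk W ++ [d.reverse] := by simp [revWalk]

@[simp] theorem edgesOf_revWalk (W : List (OrientedEdge G)) :
    edgesOf G (revWalk W) = edgesOf G W := by
  ext e; simp [mem_edgesOf, revWalk, OrientedEdge.reverse]

theorem IsWalk.revWalk {u v : V} {W : List (OrientedEdge G)} (h : IsWalk G u W v) :
    IsWalk G v (revWalk W) u := by
  induction W generalizing u with
  | nil => exact (isWalk_nil.1 h).symm
  | cons d W ih =>
    rw [revWalk_cons, isWalk_append]
    exact ⟨d.tgt, ih h.2, rfl, h.1⟩

theorem IsWalk.map_tgt_revWalk {u v : V} {W : List (OrientedEdge G)} (h : IsWalk G u W v) :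
    v :: (GainGraph.revWalk W).map OrientedEdge.tgt = (u :: W.map OrientedEdge.tgt).reverse := by
  induction W generalizing u with
  | nil => simp [GainGraph.revWalk, isWalk_nil.1 h]
  | cons d W ih =>
    rw [revWalk_cons, List.map_append, ← List.cons_append, ih h.2, List.map_cons,
      List.reverse_cons (a := u), ← h.1]
    rfl

theorem IsPath.revWalk {u v : V} {W : List (OrientedEdge G)} (h : IsPath G u W v) :
    IsPath G v (revWalk W) u :=
  ⟨h.1.revWalk, by rw [h.1.map_tgt_revWalk, List.nodup_reverse]; exact h.2⟩

theorem IsPath.of_append {u v x : V} {W W' : List (OrientedEdge G)} (h : IsPath G u (W ++ W') v)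
    (hx : IsWalk G u W x) (hx' : IsWalk G x W' v) : IsPath G u W x ∧ IsPath G x W' v := by
  have hn := h.2
  rw [List.map_append, ← List.cons_append, List.nodup_append'] at hn
  exact ⟨⟨hx, hn.1⟩, hx', List.nodup_cons.2 ⟨hn.2.2 hx.end_mem, hn.2.1⟩⟩

theorem IsPath.split {u v x : V} {W : List (OrientedEdge G)} (h : IsPath G u W v)
    (hx : x ∈ u :: W.map OrientedEdge.tgt) :
    ∃ W₁ W₂, W = W₁ ++ W₂ ∧ IsPath G u W₁ x ∧ IsPath G x W₂ v := by
  obtain ⟨W₁, W₂, rfl, h1, h2⟩ := h.1.split hx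
  exact ⟨W₁, W₂, rfl, (h.of_append h1 h2).1, (h.of_append h1 h2).2⟩

theorem IsPath.eq_nil {u : V} {W : List (OrientedEdge G)} (h : IsPath G u W u) : W = [] := by
  by_contra hn
  exact (List.nodup_cons.1 h.2).1 (h.1.end_mem_tgt hn)

theorem IsPath.cons_iff {u v : V} {d : OrientedEdge G} {W : List (OrientedEdge G)} :
    IsPath G u (d :: W) v ↔ d.src = u ∧ u ∉ d.tgt :: W.map OrientedEdge.tgt ∧
      IsPath G d.tgt W v := by
  simp only [IsPath, isWalk_cons, List.map_cons, List.nodup_cons (a := u)]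
  tauto

theorem IsPath.src_ne_tgt {u v : V} {W : List (OrientedEdge G)} (h : IsPath G u W v)
    {d : OrientedEdge G} (hd : d ∈ W) : d.src ≠ d.tgt := by
  induction W generalizing u with
  | nil => simp at hd
  | cons c W ih =>
    obtain ⟨h1, h2, h3⟩ := IsPath.cons_iff.1 h
    rcases List.mem_cons.1 hd with rfl | hd
    · rw [h1]
      exact fun he => h2 (he ▸ List.mem_cons_self)
    · exact ih h3 hd

theorem IsPath.edge_nodup {u v : V} {W : List (OrientedEdge G)} (h : IsPath G u W v) :
    (W.map OrientedEdge.edge).Nodup := by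
  induction W generalizing u with
  | nil => simp
  | cons c W ih =>
    obtain ⟨h1, h2, h3⟩ := IsPath.cons_iff.1 h
    rw [List.map_cons, List.nodup_cons]
    refine ⟨fun hm => h2 ?_, ih h3⟩
    rw [← h1]
    exact h3.1.incidentVertices_subset (mem_incidentVertices_of_edge hm).1

theorem IsPath.singleton {d : OrientedEdge G} (h : d.src ≠ d.tgt) : IsPath G d.src [d] d.tgt :=
  IsPath.cons_iff.2 ⟨rfl, by simpa using h, rfl, by simp⟩

theorem IsWalk.exists_isPath {u v : V} {W : List (OrientedEdge G)} (h : IsWalk G u W v) :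
    ∃ P, IsPath G u P v ∧ edgesOf G P ⊆ edgesOf G W := by
  induction W generalizing u with
  | nil => exact ⟨[], ⟨h, by simp⟩, by simp⟩
  | cons d W ih =>
    obtain ⟨P, hP, hs⟩ := ih h.2
    have hs' : edgesOf G P ⊆ edgesOf G (d :: W) := by
      rw [edgesOf_cons]; exact hs.trans (Set.subset_insert _ _)
    by_cases hu : u ∈ d.tgt :: P.map OrientedEdge.tgt
    · obtain ⟨P₁, P₂, rfl, -, h2⟩ := hP.split hu
      refine ⟨P₂, h2, ?_⟩
      rw [edgesOf_append] at hs'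
      exact Set.subset_union_right.trans hs'
    · refine ⟨d :: P, IsPath.cons_iff.2 ⟨h.1, hu, hP⟩, ?_⟩
      rw [edgesOf_cons, edgesOf_cons]
      exact Set.insert_subset_insert hs

/-- A simple closed walk that starts and ends at `u`. -/
def IsCycleAt (G : Graph V β) (u : V) (W : List (OrientedEdge G)) : Prop :=
  W ≠ [] ∧ IsWalk G u W u ∧ (W.map OrientedEdge.tgt).Nodup ∧ (W.map OrientedEdge.edge).Nodup

theorem isSimpleClosedWalk_iff {W : List (OrientedEdge G)} :
    IsSimpleClosedWalk G W ↔ ∃ u, IsCycleAt G u W := by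
  constructor
  · rintro ⟨h1, ⟨u, hu⟩, h2, h3⟩
    exact ⟨u, h1, hu, h2, h3⟩
  · rintro ⟨u, h1, hu, h2, h3⟩
    exact ⟨h1, ⟨u, hu⟩, h2, h3⟩

theorem IsCycleAt.isSimpleClosedWalk {u : V} {W : List (OrientedEdge G)} (h : IsCycleAt G u W) :
    IsSimpleClosedWalk G W := isSimpleClosedWalk_iff.2 ⟨u, h⟩

theorem IsCycleAt.isCycle {u : V} {W : List (OrientedEdge G)} (h : IsCycleAt G u W) :
    IsCycle G (edgesOf G W) := ⟨W, h.isSimpleClosedWalk, rfl⟩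

/-- The condition on `d.edge` excludes going along an edge and straight back, which repeats no
vertex. -/
theorem isCycleAt_cons {u : V} {d : OrientedEdge G} {P : List (OrientedEdge G)} :
    IsCycleAt G u (d :: P) ↔ d.src = u ∧ IsPath G d.tgt P u ∧ d.edge ∉ edgesOf G P := by
  constructor
  · rintro ⟨-, ⟨h1, h2⟩, h3, h4⟩
    exact ⟨h1, ⟨h2, h3⟩, (List.nodup_cons.1 h4).1⟩
  · rintro ⟨h1, h2, h3⟩
    exact ⟨by simp, ⟨h1, h2.1⟩, h2.2, List.nodup_cons.2 ⟨h3, h2.edge_nodup⟩⟩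

theorem IsCycleAt.mem_incidentVertices {u x : V} {W : List (OrientedEdge G)}
    (h : IsCycleAt G u W) :
    x ∈ incidentVertices G (edgesOf G W) ↔ x ∈ W.map OrientedEdge.tgt := by
  refine ⟨fun hx => ?_, mem_incidentVertices_of_mem_tgt⟩
  rcases List.mem_cons.1 (h.2.1.incidentVertices_subset hx) with rfl | hx
  · exact h.2.1.end_mem_tgt h.1
  · exact hx

theorem IsCycleAt.base_mem {u : V} {W : List (OrientedEdge G)} (h : IsCycleAt G u W) :
    u ∈ incidentVertices G (edgesOf G W) :=
  h.mem_incidentVertices.2 (h.2.1.end_mem_tgt h.1)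

theorem IsCycleAt.rotate {u x : V} {W₁ W₂ : List (OrientedEdge G)}
    (h : IsCycleAt G u (W₁ ++ W₂)) (h1 : IsWalk G u W₁ x) (h2 : IsWalk G x W₂ u) :
    IsCycleAt G x (W₂ ++ W₁) := by
  obtain ⟨hne, -, h3, h4⟩ := h
  refine ⟨fun he => hne ?_, isWalk_append.2 ⟨u, h2, h1⟩, ?_, ?_⟩
  · rw [List.append_eq_nil_iff] at he ⊢
    exact he.symm
  · rw [List.map_append] at h3 ⊢
    exact (List.perm_append_comm.nodup_iff).1 h3
  · rw [List.map_append] at h4 ⊢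
    exact (List.perm_append_comm.nodup_iff).1 h4

theorem IsCycle.exists_isCycleAt {D : Set β} (h : IsCycle G D) {x : V}
    (hx : x ∈ incidentVertices G D) : ∃ W, IsCycleAt G x W ∧ edgesOf G W = D := by
  obtain ⟨W, hW, rfl⟩ := h
  obtain ⟨u, hu⟩ := isSimpleClosedWalk_iff.1 hW
  obtain ⟨W₁, W₂, rfl, h1, h2⟩ := hu.2.1.split (hu.2.1.incidentVertices_subset hx)
  refine ⟨W₂ ++ W₁, hu.rotate h1 h2, ?_⟩
  rw [edgesOf_append, edgesOf_append, Set.union_comm]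

theorem IsCycle.nonempty {D : Set β} (h : IsCycle G D) : D.Nonempty := by
  obtain ⟨W, ⟨hne, -⟩, rfl⟩ := h
  obtain ⟨d, W', rfl⟩ := List.exists_cons_of_ne_nil hne
  exact ⟨d.edge, by simp⟩

theorem IsCycle.subset_edgeSet {D : Set β} (h : IsCycle G D) : D ⊆ E(G) := by
  obtain ⟨W, -, rfl⟩ := h
  exact edgesOf_subset_edgeSet W

theorem isTheta_of_paths {u v : V} {P Q R : List (OrientedEdge G)} (huv : u ≠ v)
    (hP : IsPath G u P v) (hQ : IsPath G u Q v) (hR : IsPath G u R v)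
    (hPQ : Disjoint (edgesOf G P) (edgesOf G Q)) (hPR : Disjoint (edgesOf G P) (edgesOf G R))
    (hQR : Disjoint (edgesOf G Q) (edgesOf G R))
    (hPQ' : ∀ x ∈ u :: P.map OrientedEdge.tgt, x ∈ u :: Q.map OrientedEdge.tgt → x = u ∨ x = v)
    (hPR' : ∀ x ∈ u :: P.map OrientedEdge.tgt, x ∈ u :: R.map OrientedEdge.tgt → x = u ∨ x = v)
    (hQR' : ∀ x ∈ u :: Q.map OrientedEdge.tgt, x ∈ u :: R.map OrientedEdge.tgt → x = u ∨ x = v) :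
    IsTheta G (edgesOf G P ∪ edgesOf G Q ∪ edgesOf G R) := by
  refine ⟨u, v, ![P, Q, R], huv, ?_, ?_, ?_, ?_⟩
  · intro i
    fin_cases i
    exacts [hP, hQ, hR]
  · intro i j hij
    fin_cases i <;> fin_cases j <;> first | exact absurd rfl hij | skip
    exacts [hPQ, hPR, hPQ.symm, hQR, hPR.symm, hQR.symm]
  · intro i j hij x hx hy
    fin_cases i <;> fin_cases j <;> first | exact absurd rfl hij | skip
    exacts [hPQ' x hx hy, hPR' x hx hy, hPQ' x hy hx, hQR' x hx hy, hPR' x hy hx, hQR' x hy hx]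
  · ext e
    simp [Fin.exists_fin_succ, or_assoc]

/-! ### Ears of cycles, and theta graphs and handcuffs in unions of two cycles. -/

theorem IsWalk.first_hit {u v : V} {W : List (OrientedEdge G)} (h : IsWalk G u W v)
    (hW : W ≠ []) {S : Set V} (hv : v ∈ S) :
    ∃ W₁ d W₂, W = W₁ ++ d :: W₂ ∧ IsWalk G u (W₁ ++ [d]) d.tgt ∧ IsWalk G d.tgt W₂ v ∧
      d.tgt ∈ S ∧ ∀ c ∈ W₁, c.tgt ∉ S := by
  induction W generalizing u with
  | nil => exact absurd rfl hW
  | cons c W ih =>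
    by_cases hc : c.tgt ∈ S
    · exact ⟨[], c, W, rfl, ⟨h.1, rfl⟩, h.2, hc, by simp⟩
    · have hW' : W ≠ [] := by
        rintro rfl
        exact hc ((isWalk_nil.1 h.2) ▸ hv)
      obtain ⟨W₁, d, W₂, rfl, h1, h2, h3, h4⟩ := ih h.2 hW'
      refine ⟨c :: W₁, d, W₂, rfl, ⟨h.1, h1⟩, h2, h3, ?_⟩
      intro b hb
      rcases List.mem_cons.1 hb with rfl | hb
      · exact hc
      · exact h4 b hb

/-- Cut the walk at its visits to `S` and keep the piece that contains `f`. -/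
theorem IsWalk.exists_ear {S : Set V} {f : β} :
    ∀ (n : ℕ) {u v : V} {W : List (OrientedEdge G)}, W.length = n → IsWalk G u W v → u ∈ S →
      v ∈ S → f ∈ edgesOf G W →
      ∃ A W₁ d B x, W = A ++ (W₁ ++ [d]) ++ B ∧ x ∈ S ∧ d.tgt ∈ S ∧
        IsWalk G x (W₁ ++ [d]) d.tgt ∧ f ∈ edgesOf G (W₁ ++ [d]) ∧ ∀ c ∈ W₁, c.tgt ∉ S := by
  intro n
  induction n using Nat.strong_induction_on with
  | _ n ih =>
    intro u v W hn h hu hv hf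
    have hW : W ≠ [] := by
      rintro rfl
      simp at hf
    obtain ⟨W₁, d, W₂, rfl, h1, h2, h3, h4⟩ := h.first_hit hW hv
    by_cases hf1 : f ∈ edgesOf G (W₁ ++ [d])
    · exact ⟨[], W₁, d, W₂, u, by simp, hu, h3, h1, hf1, h4⟩
    · have hf2 : f ∈ edgesOf G W₂ := by
        simp only [edgesOf_append, edgesOf_cons, edgesOf_nil, Set.mem_union,
          Set.mem_insert_iff, Set.mem_empty_iff_false, or_false] at hf hf1
        tauto
      obtain ⟨A, Z, c, B, x, rfl, hr⟩ := ih W₂.length (by simp at hn; omega) rfl h2 h3 hv hf2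
      exact ⟨W₁ ++ d :: A, Z, c, B, x, by simp, hr⟩

theorem IsCycleAt.split {x y : V} (hxy : x ≠ y) {W : List (OrientedEdge G)}
    (h : IsCycleAt G x W) (hy : y ∈ incidentVertices G (edgesOf G W)) :
    ∃ P Q, IsPath G x P y ∧ IsPath G x Q y ∧ Disjoint (edgesOf G P) (edgesOf G Q) ∧
      (∀ z ∈ x :: P.map OrientedEdge.tgt, z ∈ x :: Q.map OrientedEdge.tgt → z = x ∨ z = y) ∧
      edgesOf G P ∪ edgesOf G Q = edgesOf G W := by
  obtain ⟨P, Q, rfl, hP, hQ⟩ := h.2.1.split (h.2.1.incidentVertices_subset hy)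
  obtain ⟨-, -, h3, h4⟩ := h
  rw [List.map_append, List.nodup_append'] at h3 h4
  have hPne : P ≠ [] := fun h0 => hxy (by subst h0; exact hP)
  have hQne : Q ≠ [] := fun h0 => hxy (by subst h0; exact hQ.symm)
  have hP' : IsPath G x P y :=
    ⟨hP, List.nodup_cons.2 ⟨fun hm => h3.2.2 hm (hQ.end_mem_tgt hQne), h3.1⟩⟩
  have hQ' : IsPath G y Q x :=
    ⟨hQ, List.nodup_cons.2 ⟨fun hm => h3.2.2 (hP.end_mem_tgt hPne) hm, h3.2.1⟩⟩
  refine ⟨P, revWalk Q, hP', hQ'.revWalk, ?_, ?_, by simp⟩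
  · rw [edgesOf_revWalk, Set.disjoint_left]
    exact fun e he he' => h4.2.2 he he'
  · intro z hz hz'
    rw [hQ.map_tgt_revWalk, List.mem_reverse] at hz'
    rcases List.mem_cons.1 hz with rfl | hz
    · exact Or.inl rfl
    rcases List.mem_cons.1 hz' with rfl | hz'
    · exact Or.inr rfl
    exact (h3.2.2 hz hz').elim

/-- If a cycle `D'` meets a cycle `D` in a vertex and contains an edge outside of `D`, then
the union of the two cycles contains a theta graph or a tight handcuff. -/
theorem exists_thetaOrHandcuff_of_meet {D D' : Set β} (hD : IsCycle G D) (hD' : IsCycle G D')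
    {x₀ : V} (hx₀ : x₀ ∈ incidentVertices G D) (hx₀' : x₀ ∈ incidentVertices G D') {f : β}
    (hf' : f ∈ D') (hf : f ∉ D) : ∃ C ⊆ D ∪ D', IsThetaOrHandcuff G C := by
  obtain ⟨W, hW, rfl⟩ := hD'.exists_isCycleAt hx₀'
  obtain ⟨A, Z, d, B, x, rfl, hxS, hyS, hw, hfe, hint⟩ :=
    hW.2.1.exists_ear _ rfl hx₀ hx₀ hf'
  have hsub : edgesOf G (Z ++ [d]) ⊆ edgesOf G (A ++ (Z ++ [d]) ++ B) := by
    intro e he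
    rw [edgesOf_append, edgesOf_append]
    exact Or.inl (Or.inr he)
  obtain ⟨-, -, h3, h4⟩ := hW
  have h3' : ((Z ++ [d]).map OrientedEdge.tgt).Nodup := by
    rw [List.map_append, List.map_append (l₁ := A)] at h3
    exact h3.of_append_left.of_append_right
  have h4' : ((Z ++ [d]).map OrientedEdge.edge).Nodup := by
    rw [List.map_append, List.map_append (l₁ := A)] at h4
    exact h4.of_append_left.of_append_right
  have htgt : ∀ c ∈ Z ++ [d], c.tgt ∈ incidentVertices G D → c = d := by
    intro c hc hcS
    rcases List.mem_append.1 hc with hc | hc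
    · exact absurd hcS (hint c hc)
    · simpa using hc
  -- An edge of the ear that is in `D` has both ends on `D`. Its target makes it the last edge and
  -- its source makes it the first, so the ear would be `f` alone.
  have hdis : Disjoint D (edgesOf G (Z ++ [d])) := by
    rw [Set.disjoint_left]
    intro e heD he
    obtain ⟨c, hc, rfl⟩ := mem_edgesOf.1 he
    obtain ⟨hs, ht⟩ := mem_incidentVertices_of_edge heD
    obtain rfl := htgt c hc ht
    have hZ : Z = [] := by
      rcases List.eq_nil_or_concat Z with h0 | ⟨Z', b, hZ'⟩
      · exact h0
      · exfalso
        subst hZ'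
        obtain ⟨y, h1, h2⟩ := isWalk_append.1 hw
        rw [List.concat_eq_append] at h1
        obtain ⟨y', -, h1'⟩ := isWalk_append.1 h1
        have : b.tgt = c.src := h1'.2.trans h2.1.symm
        exact hint b (by simp) (this ▸ hs)
    subst hZ
    have : f = c.edge := by simpa using hfe
    exact hf (this ▸ heD)
  -- A closed ear forms a tight handcuff with `D`; an open one forms a theta graph with the two arcs
  -- of `D`.
  by_cases hxy : x = d.tgt
  · have hcyc : IsCycleAt G x (Z ++ [d]) :=
      ⟨by simp, by rw [← hxy] at hw; exact hw, h3', h4'⟩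
    refine ⟨D ∪ edgesOf G (Z ++ [d]), Set.union_subset_union_right _ hsub,
      Or.inr (Or.inl ⟨D, _, hD, hcyc.isCycle, hdis, ⟨x, ?_⟩, rfl⟩)⟩
    ext z
    rw [Set.mem_inter_iff, Set.mem_singleton_iff]
    constructor
    · rintro ⟨hz, hz'⟩
      rw [hcyc.mem_incidentVertices] at hz'
      obtain ⟨c, hc, rfl⟩ := List.mem_map.1 hz'
      rw [htgt c hc hz, hxy]
    · rintro rfl
      exact ⟨hxS, hcyc.base_mem⟩
  · obtain ⟨WD, hWD, rfl⟩ := hD.exists_isCycleAt hxS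
    obtain ⟨P, Q, hP, hQ, hPQ, hPQ', hun⟩ := hWD.split hxy hyS
    have hR : IsPath G x (Z ++ [d]) d.tgt := by
      refine ⟨hw, List.nodup_cons.2 ⟨fun hm => ?_, h3'⟩⟩
      obtain ⟨c, hc, hcx⟩ := List.mem_map.1 hm
      exact hxy (by rw [← hcx, htgt c hc (hcx ▸ hxS)])
    have hne : ∀ {P}, IsPath G x P d.tgt → P ≠ [] := by
      rintro _ ⟨h, -⟩ rfl
      exact hxy h
    have hvs : ∀ {P}, IsPath G x P d.tgt → edgesOf G P ⊆ edgesOf G WD →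
        ∀ z ∈ x :: P.map OrientedEdge.tgt, z ∈ x :: (Z ++ [d]).map OrientedEdge.tgt →
          z = x ∨ z = d.tgt := by
      intro P hP hPs z hz hz'
      rcases List.mem_cons.1 hz with rfl | hz
      · exact Or.inl rfl
      rcases List.mem_cons.1 hz' with rfl | hz'
      · exact Or.inl rfl
      obtain ⟨c, hc, rfl⟩ := List.mem_map.1 hz'
      right
      rw [htgt c hc (incidentVertices_mono hPs (mem_incidentVertices_of_mem_tgt hz))]
    have hPs : edgesOf G P ⊆ edgesOf G WD := hun ▸ Set.subset_union_left
    have hQs : edgesOf G Q ⊆ edgesOf G WD := hun ▸ Set.subset_union_right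
    refine ⟨edgesOf G P ∪ edgesOf G Q ∪ edgesOf G (Z ++ [d]), ?_, Or.inl ?_⟩
    · rw [hun]
      exact Set.union_subset_union_right _ hsub
    · exact isTheta_of_paths hxy hP hQ hR hPQ (hdis.mono_left hPs) (hdis.mono_left hQs) hPQ'
        (hvs hP hPs) (hvs hQ hQs)

/-- Two vertex-disjoint cycles that are connected by a walk in `X` yield a loose handcuff. -/
theorem exists_looseHandcuff {X D D' : Set β} (hD : IsCycle G D) (hD' : IsCycle G D')
    (hdis : Disjoint (incidentVertices G D) (incidentVertices G D')) (hDX : D ⊆ X) (hDX' : D' ⊆ X)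
    {x y : V} {W : List (OrientedEdge G)} (hx : x ∈ incidentVertices G D)
    (hy : y ∈ incidentVertices G D') (hW : IsWalk G x W y) (hWX : edgesOf G W ⊆ X) :
    ∃ C ⊆ X, IsLooseHandcuff G C := by
  classical
  -- A shortest path between the two cycles meets them only in its ends.
  have hex : ∃ n : ℕ, ∃ u ∈ incidentVertices G D, ∃ v ∈ incidentVertices G D', ∃ P,
      IsPath G u P v ∧ edgesOf G P ⊆ X ∧ P.length = n := by
    obtain ⟨P, hP, hs⟩ := hW.exists_isPath
    exact ⟨_, x, hx, y, hy, P, hP, hs.trans hWX, rfl⟩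
  obtain ⟨u, hu, v, hv, P, hP, hPX, hlen⟩ := Nat.find_spec hex
  have hmin := fun m hm => Nat.find_min (m := m) hex hm
  refine ⟨D ∪ D' ∪ edgesOf G P, Set.union_subset (Set.union_subset hDX hDX') hPX, D, D', u, v, P,
    hD, hD', hdis, hP, fun z hz => ?_, rfl⟩
  obtain ⟨P₁, P₂, rfl, h1, h2⟩ := hP.split hz
  rw [edgesOf_append, Set.union_subset_iff] at hPX
  rw [List.length_append] at hlen
  refine ⟨⟨fun hzD => ?_, fun h => h ▸ hu⟩, ⟨fun hzD => ?_, fun h => h ▸ hv⟩⟩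
  · by_contra hne
    have hl : 0 < P₁.length := List.length_pos_iff.2 fun h0 => hne (by subst h0; exact h1.1.symm)
    exact hmin P₂.length (by omega) ⟨z, hzD, v, hv, P₂, h2, hPX.2, rfl⟩
  · by_contra hne
    have hl : 0 < P₂.length := List.length_pos_iff.2 fun h0 => hne (by subst h0; exact h2.1)
    exact hmin P₁.length (by omega) ⟨u, hu, z, hzD, P₁, h1, hPX.1, rfl⟩

theorem exists_thetaOrHandcuff {X D D' : Set β} (hD : IsCycle G D) (hD' : IsCycle G D')
    (hne : D ≠ D') (hDX : D ⊆ X) (hDX' : D' ⊆ X) {x y : V} {W : List (OrientedEdge G)}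
    (hx : x ∈ incidentVertices G D) (hy : y ∈ incidentVertices G D') (hW : IsWalk G x W y)
    (hWX : edgesOf G W ⊆ X) : ∃ C ⊆ X, IsThetaOrHandcuff G C := by
  by_cases hdis : Disjoint (incidentVertices G D) (incidentVertices G D')
  · obtain ⟨C, hC, h⟩ := exists_looseHandcuff hD hD' hdis hDX hDX' hx hy hW hWX
    exact ⟨C, hC, Or.inr (Or.inr h)⟩
  · obtain ⟨z, hz, hz'⟩ := Set.not_disjoint_iff.1 hdis
    by_cases hs : D' ⊆ D
    · obtain ⟨f, hf, hf'⟩ := Set.not_subset.1 fun h => hne (h.antisymm hs)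
      obtain ⟨C, hC, h⟩ := exists_thetaOrHandcuff_of_meet hD' hD hz' hz hf hf'
      exact ⟨C, hC.trans (Set.union_subset hDX' hDX), h⟩
    · obtain ⟨f, hf, hf'⟩ := Set.not_subset.1 hs
      obtain ⟨C, hC, h⟩ := exists_thetaOrHandcuff_of_meet hD hD' hz hz' hf hf'
      exact ⟨C, hC.trans (Set.union_subset hDX hDX'), h⟩

end Walks

/-! ### Gains of walks -/

section WalkGain

variable {V β Γ : Type*} [Group Γ] {G : Graph V β} {ψ : GainFunction G Γ}

namespace GainFunction

@[simp] theorem walkGain_nil : ψ.walkGain [] = 1 := rfl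

@[simp] theorem walkGain_cons (d : OrientedEdge G) (W : List (OrientedEdge G)) :
    ψ.walkGain (d :: W) = ψ.gain d * ψ.walkGain W := by simp [walkGain]

@[simp] theorem walkGain_append (W W' : List (OrientedEdge G)) :
    ψ.walkGain (W ++ W') = ψ.walkGain W * ψ.walkGain W' := by simp [walkGain]

end GainFunction

/-- This would fail for walks through loops, whose gain is not inverted by reversal. -/
theorem IsPath.walkGain_revWalk {u v : V} {P : List (OrientedEdge G)} (h : IsPath G u P v) :
    ψ.walkGain (GainGraph.revWalk P) = (ψ.walkGain P)⁻¹ := by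
  induction P generalizing u with
  | nil => simp [GainGraph.revWalk]
  | cons d P ih =>
    have hd := ψ.gain_reverse d (h.src_ne_tgt List.mem_cons_self)
    simp [ih (IsPath.cons_iff.1 h).2.2, hd]

theorem IsWalk.span {u v : V} {W : List (OrientedEdge G)} (h : IsWalk G u W v) {X : Set β}
    (hX : edgesOf G W ⊆ X) : Span ψ X u v (ψ.walkGain W) := by
  induction W generalizing u with
  | nil => rw [isWalk_nil.1 h]; exact .refl v
  | cons d W ih =>
    rw [edgesOf_cons, Set.insert_subset_iff] at hX
    rw [GainFunction.walkGain_cons, ← h.1]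
    exact .trans (.edge d hX.1) (ih h.2 hX.2)

theorem IsWalk.conn {u v : V} {W : List (OrientedEdge G)} (h : IsWalk G u W v) {X : Set β}
    (hX : edgesOf G W ⊆ X) : Conn (Span ψ X) u v := ⟨_, h.span hX⟩

theorem IsCycleAt.exists_cons {u : V} {W : List (OrientedEdge G)} (h : IsCycleAt G u W)
    {e : β} (he : e ∈ edgesOf G W) (ψ : GainFunction G Γ) :
    ∃ d P, d.edge = e ∧ IsCycleAt G d.src (d :: P) ∧ edgesOf G (d :: P) = edgesOf G W ∧
      (ψ.walkGain (d :: P) = 1 ↔ ψ.walkGain W = 1) := by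
  obtain ⟨d, hd, rfl⟩ := mem_edgesOf.1 he
  obtain ⟨A, B, rfl⟩ := List.append_of_mem hd
  obtain ⟨x, h1, h2⟩ := isWalk_append.1 h.2.1
  have h2' := h2
  rw [isWalk_cons] at h2'
  obtain rfl := h2'.1
  refine ⟨d, B ++ A, rfl, h.rotate h1 h2, ?_, ?_⟩
  · rw [← List.cons_append, edgesOf_append, edgesOf_append, Set.union_comm]
  · rw [← List.cons_append, ψ.walkGain_append, ψ.walkGain_append, mul_eq_one_comm]

theorem IsCycle.exists_cons {D : Set β} (h : IsCycle G D) {e : β} (he : e ∈ D) :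
    ∃ d P, d.edge = e ∧ IsCycleAt G d.src (d :: P) ∧ edgesOf G (d :: P) = D := by
  obtain ⟨W, hW, rfl⟩ := h
  obtain ⟨u, hu⟩ := isSimpleClosedWalk_iff.1 hW
  -- Gains are irrelevant here, so a trivial gain function is supplied.
  obtain ⟨d, P, h1, h2, h3, -⟩ := hu.exists_cons he (⟨fun _ => 1, by simp⟩ : GainFunction G Unit)
  exact ⟨d, P, h1, h2, h3⟩

end WalkGain

/-! ### Dependent sets of the frame closure contain frame circuits -/

section Dependent

variable {V β Γ : Type*} [Group Γ] {G : Graph V β} {ψ : GainFunction G Γ}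

/-- The vertex `v` is connected in `X` to a cycle contained in `X`. -/
def ConnCycle (G : Graph V β) (X : Set β) (v : V) : Prop :=
  ∃ D, IsCycle G D ∧ D ⊆ X ∧ ∃ x ∈ incidentVertices G D, ∃ W, IsWalk G v W x ∧ edgesOf G W ⊆ X

theorem ConnCycle.of_walk {X : Set β} {u v : V} (h : ConnCycle G X v) {W : List (OrientedEdge G)}
    (hW : IsWalk G u W v) (hX : edgesOf G W ⊆ X) : ConnCycle G X u := by
  obtain ⟨D, hD, hDX, x, hx, W', hW', hX'⟩ := h
  exact ⟨D, hD, hDX, x, hx, W ++ W', isWalk_append.2 ⟨v, hW, hW'⟩,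
    by rw [edgesOf_append]; exact Set.union_subset hX hX'⟩

theorem IsCycleAt.connCycle {X : Set β} {u : V} {W : List (OrientedEdge G)}
    (h : IsCycleAt G u W) (hX : edgesOf G W ⊆ X) : ConnCycle G X u :=
  ⟨_, h.isCycle, hX, u, h.base_mem, [], rfl, by simp⟩

theorem isCycleAt_loop {d : OrientedEdge G} (h : d.src = d.tgt) : IsCycleAt G d.src [d] :=
  isCycleAt_cons.2 ⟨rfl, ⟨h.symm, by simp⟩, by simp⟩

theorem IsPath.eq_singleton {u v : V} {P : List (OrientedEdge G)} (h : IsPath G u P v)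
    {c : OrientedEdge G} (hc : c ∈ P) (hu : c.src = u) (hv : c.tgt = v) : P = [c] := by
  obtain ⟨A, B, rfl⟩ := List.append_of_mem hc
  obtain ⟨x, h1, h2⟩ := isWalk_append.1 h.1
  obtain ⟨hA, hB⟩ := h.of_append h1 h2
  obtain ⟨h3, h4, h5⟩ := IsPath.cons_iff.1 hB
  subst hu hv h3
  rw [hA.eq_nil, h5.eq_nil]
  rfl

/-- If `Q` returns to the source of `d`, its initial segment closes a cycle with `d` unless it uses
the edge of `d`. In that case the segment is just `d.reverse`, and cancelling it preserves the gain.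
-/
theorem exists_isPath_cons {X : Set β} {d : OrientedEdge G} (hd : d.edge ∈ X)
    (hn : ¬ ConnCycle G X d.src) {w : V} {Q : List (OrientedEdge G)} (hQ : IsPath G d.tgt Q w)
    (hQX : edgesOf G Q ⊆ X) :
    ∃ P, IsPath G d.src P w ∧ edgesOf G P ⊆ X ∧ ψ.walkGain P = ψ.gain d * ψ.walkGain Q := by
  have hl : d.src ≠ d.tgt := fun hl => hn ((isCycleAt_loop hl).connCycle (by simpa using hd))
  by_cases hu : d.src ∈ d.tgt :: Q.map OrientedEdge.tgt
  · obtain ⟨Q₁, Q₂, rfl, h1, h2⟩ := hQ.split hu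
    rw [edgesOf_append, Set.union_subset_iff] at hQX
    have hd1 : d.edge ∈ edgesOf G Q₁ := by
      by_contra hd1
      refine hn ((isCycleAt_cons.2 ⟨rfl, h1, hd1⟩).connCycle ?_)
      rw [edgesOf_cons]
      exact Set.insert_subset hd hQX.1
    obtain ⟨c, hc, hcd⟩ := mem_edgesOf.1 hd1
    rcases OrientedEdge.eq_or_eq_reverse hcd.symm with rfl | rfl
    · exact absurd (List.mem_map_of_mem hc) (List.nodup_cons.1 h1.2).1
    · obtain rfl := h1.eq_singleton hc rfl rfl
      exact ⟨Q₂, h2, hQX.2, by simp [ψ.gain_reverse d hl]⟩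
  · refine ⟨d :: Q, IsPath.cons_iff.2 ⟨rfl, hu, hQ⟩, ?_, by simp⟩
    rw [edgesOf_cons]
    exact Set.insert_subset hd hQX

theorem exists_isPath_append {X : Set β} {u v w : V} {P Q : List (OrientedEdge G)}
    (hn : ¬ ConnCycle G X u) (hP : IsPath G u P v) (hPX : edgesOf G P ⊆ X) (hQ : IsPath G v Q w)
    (hQX : edgesOf G Q ⊆ X) :
    ∃ R, IsPath G u R w ∧ edgesOf G R ⊆ X ∧ ψ.walkGain R = ψ.walkGain P * ψ.walkGain Q := by
  induction P generalizing u with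
  | nil =>
    obtain rfl := isWalk_nil.1 hP.1
    exact ⟨Q, hQ, hQX, by simp⟩
  | cons d P ih =>
    obtain ⟨rfl, -, hP'⟩ := IsPath.cons_iff.1 hP
    rw [edgesOf_cons, Set.insert_subset_iff] at hPX
    have hn' : ¬ ConnCycle G X d.tgt := fun h =>
      hn (h.of_walk (W := [d]) ⟨rfl, rfl⟩ (by simpa using hPX.1))
    obtain ⟨R, hR, hRX, hg⟩ := ih hn' hP' hPX.2
    obtain ⟨S, hS, hSX, hg'⟩ := exists_isPath_cons (ψ := ψ) hPX.1 hn hR hRX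
    exact ⟨S, hS, hSX, by rw [hg', hg, ψ.walkGain_cons, mul_assoc]⟩

/-- Where no cycle can be reached, a component is a tree, and concatenated paths reduce to paths of
the same gain by cancelling backtracks. Balance of the cycles is ignored on purpose: balanced cycles
are treated separately when a frame circuit is sought. -/
theorem isGainRel_path (ψ : GainFunction G Γ) (X : Set β) : IsGainRel fun u v k =>
    (∃ P, IsPath G u P v ∧ edgesOf G P ⊆ X ∧ ψ.walkGain P = k) ∨
      (ConnCycle G X u ∧ ConnCycle G X v) where
  refl u := Or.inl ⟨[], ⟨rfl, by simp⟩, by simp, rfl⟩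
  symm := by
    rintro u v k (⟨P, hP, hX, rfl⟩ | ⟨hu, hv⟩)
    · exact Or.inl ⟨revWalk P, hP.revWalk, by simpa, hP.walkGain_revWalk⟩
    · exact Or.inr ⟨hv, hu⟩
  trans := by
    rintro u v w k l (⟨P, hP, hX, rfl⟩ | ⟨hu, hv⟩) (⟨Q, hQ, hX', rfl⟩ | ⟨hv', hw⟩)
    · by_cases hn : ConnCycle G X u
      · refine Or.inr ⟨hn, (hn.of_walk hP.revWalk.1 (by simpa)).of_walk hQ.revWalk.1 (by simpa)⟩
      · exact Or.inl (exists_isPath_append hn hP hX hQ hX')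
    · exact Or.inr ⟨hv'.of_walk hP.1 hX, hw⟩
    · exact Or.inr ⟨hu, hv.of_walk hQ.revWalk.1 (by simpa)⟩
    · exact Or.inr ⟨hu, hw⟩
  full := by
    have key : ∀ {u k}, ((∃ P, IsPath G u P u ∧ edgesOf G P ⊆ X ∧ ψ.walkGain P = k) ∨
        (ConnCycle G X u ∧ ConnCycle G X u)) → k ≠ 1 → ConnCycle G X u := by
      rintro u k (⟨P, hP, -, rfl⟩ | ⟨hu, -⟩) hk
      · rw [hP.eq_nil] at hk
        exact absurd rfl hk
      · exact hu
    intro u v g k l hg hg1 hk hk1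
    exact Or.inr ⟨key hg hg1, key hk hk1⟩

theorem Span.path_or_connCycle {X : Set β} {u v : V} {k : Γ} (h : Span ψ X u v k) :
    (∃ P, IsPath G u P v ∧ edgesOf G P ⊆ X ∧ ψ.walkGain P = k) ∨
      (ConnCycle G X u ∧ ConnCycle G X v) := by
  refine h.least (isGainRel_path ψ X) fun d hd => ?_
  by_cases hl : d.src = d.tgt
  · have hc : ConnCycle G X d.src := (isCycleAt_loop hl).connCycle (by simpa using hd)
    exact Or.inr ⟨hc, hl ▸ hc⟩
  · exact Or.inl ⟨[d], IsPath.singleton hl, by simpa using hd, by simp⟩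

/-- If `Y` connects the ends of `d`, a path in `Y` closes a new cycle with `d`, connected to an old
one. Otherwise each end reaches its own cycle, and `d` links the two. -/
theorem exists_thetaOrHandcuff_insert {Y : Set β} {d : OrientedEdge G} (hd : d.edge ∉ Y)
    (hs : ConnCycle G Y d.src) (ht : ConnCycle G Y d.tgt) :
    ∃ C ⊆ insert d.edge Y, IsThetaOrHandcuff G C := by
  have hY := Set.subset_insert d.edge Y
  obtain ⟨D, hD, hDY, x, hx, W, hW, hWY⟩ := hs
  by_cases hc : ∃ Q, IsPath G d.tgt Q d.src ∧ edgesOf G Q ⊆ Y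
  · obtain ⟨Q, hQ, hQY⟩ := hc
    have hcyc : IsCycleAt G d.src (d :: Q) := isCycleAt_cons.2 ⟨rfl, hQ, fun h => hd (hQY h)⟩
    refine exists_thetaOrHandcuff hcyc.isCycle hD ?_ ?_ (hDY.trans hY) hcyc.base_mem hx hW
      (hWY.trans hY)
    · rintro rfl
      exact hd (hDY (by simp))
    · rw [edgesOf_cons]
      exact Set.insert_subset_insert hQY
  · obtain ⟨D', hD', hDY', x', hx', W', hW', hWY'⟩ := ht
    refine exists_thetaOrHandcuff (W := revWalk W ++ d :: W') hD hD' ?_ (hDY.trans hY)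
      (hDY'.trans hY) hx hx' (isWalk_append.2 ⟨_, hW.revWalk, rfl, hW'⟩) ?_
    -- If both ends reached the same cycle, a detour through it would connect them in `Y`.
    · rintro rfl
      obtain ⟨Z, hZ, rfl⟩ := hD.exists_isCycleAt hx'
      obtain ⟨Z₁, Z₂, rfl, h1, h2⟩ := hZ.2.1.split (hZ.2.1.incidentVertices_subset hx)
      obtain ⟨Q, hQ, hQs⟩ := (isWalk_append.2
        ⟨x, isWalk_append.2 ⟨x', hW', h1⟩, hW.revWalk⟩).exists_isPath
      refine hc ⟨Q, hQ, hQs.trans ?_⟩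
      simp only [edgesOf_append, edgesOf_revWalk, Set.union_subset_iff] at hDY ⊢
      exact ⟨⟨hWY', hDY.1⟩, hWY⟩
    · simp only [edgesOf_append, edgesOf_cons, edgesOf_revWalk]
      exact Set.union_subset (hWY.trans hY) (Set.insert_subset_insert hWY')

/-- If there is no balanced cycle in `insert e Y`, any theta graph or handcuff in it is a frame
circuit. A spanned gain realised by a path would close a balanced cycle with `e`, so both ends of
`e` reach cycles in `Y`. -/
theorem exists_frameCircuit {Y : Set β} {e : β} (heE : e ∈ E(G)) (he : e ∉ Y)
    (hcl : e ∈ frameCl ψ Y) : ∃ C ⊆ insert e Y, IsFrameCircuit G ψ.balancedCycles C := by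
  by_cases hb : ∃ C ⊆ insert e Y, C ∈ ψ.balancedCycles
  · obtain ⟨C, hC, hCb⟩ := hb
    exact ⟨C, hC, Or.inl hCb⟩
  obtain ⟨x, y, hl⟩ := Graph.exists_isLink_of_mem_edgeSet heE
  obtain ⟨d, rfl⟩ : ∃ d : OrientedEdge G, d.edge = e := ⟨⟨e, x, y, hl⟩, rfl⟩
  rcases (hcl d rfl).path_or_connCycle with ⟨P, hP, hPY, hg⟩ | ⟨hs, ht⟩
  · have hdP : d.edge ∉ edgesOf G P := fun h => he (hPY h)
    by_cases hl : d.src = d.tgt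
    · rw [← hl] at hP
      obtain rfl := hP.eq_nil
      exact absurd ⟨edgesOf G [d], by simp, [d], (isCycleAt_loop hl).isSimpleClosedWalk, rfl,
        by simpa using hg.symm⟩ hb
    -- The path runs parallel to `d` with the same gain, so `d` closes it in the reverse direction.
    · have hcyc : IsCycleAt G d.reverse.src (d.reverse :: P) := isCycleAt_cons.2 ⟨rfl, hP, hdP⟩
      refine absurd ⟨edgesOf G (d.reverse :: P), ?_, _, hcyc.isSimpleClosedWalk, rfl, ?_⟩ hb
      · rw [edgesOf_cons]
        exact Set.insert_subset_insert hPY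
      · rw [ψ.walkGain_cons, hg, ψ.gain_reverse d hl, mul_inv_cancel]
  · obtain ⟨C, hC, h⟩ := exists_thetaOrHandcuff_insert he hs ht
    exact ⟨C, hC, Or.inr ⟨h, fun D hD _ hDb => hb ⟨D, hD.trans hC, hDb⟩⟩⟩

end Dependent

/-! ### Frame circuits are circuits of the frame closure -/

section Independent

variable {V β Γ : Type*} [Group Γ] {G : Graph V β} {ψ : GainFunction G Γ}

/-- All edges in `X` have the gain given by the potential `η`. -/
def IsPotential (ψ : GainFunction G Γ) (η : V → Γ) (X : Set β) : Prop :=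
  ∀ d : OrientedEdge G, d.edge ∈ X → ψ.gain d = (η d.src)⁻¹ * η d.tgt

/-- Closed gains are trivial here, so no vertex is unbalanced and `full` holds vacuously. -/
theorem isGainRel_potential (η : V → Γ) : IsGainRel fun u v (k : Γ) => k = (η u)⁻¹ * η v where
  refl u := by simp
  symm := by rintro u v _ rfl; simp
  trans := by rintro u v w _ _ rfl rfl; group
  full := by
    rintro u v g k l rfl hg
    exact absurd (inv_mul_cancel _) hg

theorem IsPotential.span_eq {η : V → Γ} {X : Set β} (h : IsPotential ψ η X) {u v : V} {k : Γ}
    (hs : Span ψ X u v k) : k = (η u)⁻¹ * η v :=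
  hs.least (isGainRel_potential η) h

theorem IsPotential.mono {η : V → Γ} {X Y : Set β} (h : IsPotential ψ η Y) (hXY : X ⊆ Y) :
    IsPotential ψ η X := fun d hd => h d (hXY hd)

theorem IsPotential.insert_edge {η : V → Γ} {X : Set β} (h : IsPotential ψ η X) {d : OrientedEdge G}
    (hd : ψ.gain d = (η d.src)⁻¹ * η d.tgt) : IsPotential ψ η (insert d.edge X) := by
  rintro c (hc | hc)
  · exact GainFunction.rel_of_rel (isGainRel_potential η) hc.symm hd
  · exact h c hc

theorem IsPath.exists_isPotential {u v : V} {P : List (OrientedEdge G)} (h : IsPath G u P v)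
    (ψ : GainFunction G Γ) : ∃ η, IsPotential ψ η (edgesOf G P) := by
  classical
  induction P generalizing u with
  | nil => exact ⟨fun _ => 1, fun d hd => by simp at hd⟩
  | cons d P ih =>
    obtain ⟨rfl, hu, hP⟩ := IsPath.cons_iff.1 h
    obtain ⟨η, hη⟩ := ih hP
    have hne : d.tgt ≠ d.src := fun he => hu (he ▸ List.mem_cons_self)
    refine ⟨Function.update η d.src (η d.tgt * (ψ.gain d)⁻¹), ?_⟩
    rw [edgesOf_cons]
    refine IsPotential.insert_edge (fun c hc => ?_) ?_
    · obtain ⟨hs, ht⟩ := mem_incidentVertices_of_edge hc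
      have hs' : c.src ≠ d.src := fun he => hu (he ▸ hP.1.incidentVertices_subset hs)
      have ht' : c.tgt ≠ d.src := fun he => hu (he ▸ hP.1.incidentVertices_subset ht)
      rw [Function.update_of_ne hs', Function.update_of_ne ht']
      exact hη c hc
    · rw [Function.update_self, Function.update_of_ne hne]
      group

/-- Relating `w` only to itself, with gain `1`, is consistent with all the closure rules. -/
theorem Span.eq_of_notMem {X : Set β} {w : V} (hw : w ∉ incidentVertices G X) {u v : V} {k : Γ}
    (h : Span ψ X u v k) : (u = w ∨ v = w) → u = v ∧ k = 1 := by
  refine h.least (R := fun u v k => (u = w ∨ v = w) → u = v ∧ k = 1) ⟨?_, ?_, ?_, ?_⟩ ?_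
  · exact fun u _ => ⟨rfl, rfl⟩
  · intro u v k h h'
    obtain ⟨rfl, rfl⟩ := h h'.symm
    simp
  · rintro u v x k l h h' (rfl | rfl)
    · obtain ⟨rfl, rfl⟩ := h (Or.inl rfl)
      obtain ⟨rfl, rfl⟩ := h' (Or.inl rfl)
      simp
    · obtain ⟨rfl, rfl⟩ := h' (Or.inr rfl)
      obtain ⟨rfl, rfl⟩ := h (Or.inr rfl)
      simp
  · rintro u v k l m h hk h' hl (rfl | rfl)
    · exact absurd (h (Or.inl rfl)).2 hk
    · exact absurd (h' (Or.inl rfl)).2 hl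
  · rintro d hd (rfl | rfl)
    · exact absurd (mem_incidentVertices_of_edge hd).1 hw
    · exact absurd (mem_incidentVertices_of_edge hd).2 hw

/-- Each step of the path reaches a vertex not incident with any earlier edge, so the new edge is
not spanned. -/
theorem clIndep_union_path {X : Set β} (hX : ClIndep (frameCl ψ) X) {u v : V}
    {P : List (OrientedEdge G)} (hP : IsPath G u P v)
    (hd : ∀ x ∈ P.map OrientedEdge.tgt, x ∉ incidentVertices G X) :
    ClIndep (frameCl ψ) (X ∪ edgesOf G P) := by
  induction P generalizing u X with
  | nil => simpa
  | cons d P ih =>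
    obtain ⟨rfl, hu, hP'⟩ := IsPath.cons_iff.1 hP
    rw [edgesOf_cons, Set.union_insert, ← Set.insert_union]
    refine ih ?_ hP' ?_
    · refine (isExchangeClosure_frameCl ψ).clIndep_insert hX fun hm => ?_
      have := (hm d rfl).eq_of_notMem (hd d.tgt (by simp)) (Or.inr rfl)
      exact hu (this.1 ▸ List.mem_cons_self)
    · rintro x hx ⟨e, he | he, hxe⟩
      · subst he
        rcases hxe.eq_or_eq_of_isLink d.isLink with rfl | rfl
        · exact hu (List.mem_cons_of_mem _ hx)
        · exact (List.nodup_cons.1 hP'.2).1 hx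
      · exact hd x (List.mem_cons_of_mem _ hx) ⟨e, he, hxe⟩

theorem IsPath.clIndep {u v : V} {P : List (OrientedEdge G)} (hP : IsPath G u P v)
    (ψ : GainFunction G Γ) : ClIndep (frameCl ψ) (edgesOf G P) := by
  have := clIndep_union_path (ψ := ψ) (X := ∅) (fun e he => absurd he (Set.notMem_empty e)) hP
    (by rintro x - ⟨e, he, -⟩; exact he)
  rwa [Set.empty_union] at this

theorem IsCycle.clIndep {D : Set β} (hD : IsCycle G D) (hu : D ∉ ψ.balancedCycles) :
    ClIndep (frameCl ψ) D := by
  obtain ⟨e, he⟩ := hD.nonempty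
  obtain ⟨d, P, rfl, hc, rfl⟩ := hD.exists_cons he
  obtain ⟨-, hP, hd⟩ := isCycleAt_cons.1 hc
  rw [edgesOf_cons]
  refine (isExchangeClosure_frameCl ψ).clIndep_insert (hP.clIndep ψ) fun hm => hu
    ⟨_, hc.isSimpleClosedWalk, rfl, ?_⟩
  -- A potential on the path allows only one gain between its ends, so a spanned closing edge makes
  -- the cycle balanced.
  obtain ⟨η, hη⟩ := hP.exists_isPotential ψ
  rw [ψ.walkGain_cons, hη.span_eq (hm d rfl), hη.span_eq (hP.1.span subset_rfl)]
  group

theorem IsCycle.unb {D X : Set β} (hD : IsCycle G D) (hu : D ∉ ψ.balancedCycles) (hDX : D ⊆ X)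
    {x : V} (hx : x ∈ incidentVertices G D) : Unb (Span ψ X) x := by
  obtain ⟨W, hW, rfl⟩ := hD.exists_isCycleAt hx
  exact ⟨_, hW.2.1.span hDX, fun h1 => hu ⟨W, hW.isSimpleClosedWalk, rfl, h1⟩⟩

theorem mem_frameCl_of_unb {X : Set β} {d : OrientedEdge G} (hs : Unb (Span ψ X) d.src)
    (ht : Unb (Span ψ X) d.tgt) : d.edge ∈ frameCl ψ X :=
  (mem_frameCl_iff d).2 ((isGainRel_span ψ X).full' _ hs ht)

/-- The two conclusions, here and for theta graphs and handcuffs, are what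
`IsExchangeClosure.isCircuit` needs. -/
theorem balancedCycle_spec {C : Set β} (hC : C ∈ ψ.balancedCycles) :
    (∀ e ∈ C, e ∈ frameCl ψ (C \ {e})) ∧ ∃ e ∈ C, ClIndep (frameCl ψ) (C \ {e}) := by
  obtain ⟨W, hW, rfl, hg⟩ := hC
  obtain ⟨u, hu⟩ := isSimpleClosedWalk_iff.1 hW
  have key : ∀ e ∈ edgesOf G W, ∃ (d : OrientedEdge G) (P : List (OrientedEdge G)), d.edge = e ∧
      IsPath G d.tgt P d.src ∧ edgesOf G W \ {e} = edgesOf G P ∧ ψ.gain d * ψ.walkGain P = 1 := by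
    intro e he
    obtain ⟨d, P, rfl, hc, hs, hg'⟩ := hu.exists_cons he ψ
    obtain ⟨-, hP, hd⟩ := isCycleAt_cons.1 hc
    refine ⟨d, P, rfl, hP, ?_, ?_⟩
    · rw [← hs, edgesOf_cons, Set.insert_sdiff_self_of_notMem hd]
    · rw [← ψ.walkGain_cons]; exact hg'.2 hg
  constructor
  · intro e he
    obtain ⟨d, P, rfl, hP, hs, hg'⟩ := key e he
    rw [mem_frameCl_iff, hs, eq_inv_of_mul_eq_one_left hg']
    exact .symm (hP.1.span subset_rfl)
  · obtain ⟨e, he⟩ := IsCycle.nonempty ⟨W, hW, rfl⟩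
    obtain ⟨d, P, rfl, hP, hs, -⟩ := key e he
    exact ⟨_, he, hs ▸ hP.clIndep ψ⟩

theorem IsPath.append_revWalk {u v : V} {P Q : List (OrientedEdge G)} (huv : u ≠ v)
    (hP : IsPath G u P v) (hQ : IsPath G u Q v) (hd : Disjoint (edgesOf G P) (edgesOf G Q))
    (hv : ∀ x ∈ u :: P.map OrientedEdge.tgt, x ∈ u :: Q.map OrientedEdge.tgt → x = u ∨ x = v) :
    IsCycleAt G u (P ++ GainGraph.revWalk Q) := by
  have hr := hQ.revWalk
  have hrn := List.nodup_cons.1 hr.2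
  refine ⟨?_, isWalk_append.2 ⟨v, hP.1, hr.1⟩, ?_, ?_⟩
  · intro h0
    have := (List.append_eq_nil_iff.1 h0).1
    subst this
    exact huv hP.1
  · rw [List.map_append, List.nodup_append']
    refine ⟨hP.2.of_cons, hrn.2, fun x hx hx' => ?_⟩
    have hxQ : x ∈ u :: Q.map OrientedEdge.tgt := by
      rw [← List.mem_reverse, ← hQ.1.map_tgt_revWalk]
      exact List.mem_cons_of_mem _ hx'
    rcases hv x (List.mem_cons_of_mem _ hx) hxQ with rfl | rfl
    · exact (List.nodup_cons.1 hP.2).1 hx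
    · exact hrn.1 hx'
  · rw [List.map_append, List.nodup_append']
    refine ⟨hP.edge_nodup, hr.edge_nodup, fun e he he' => ?_⟩
    have : e ∈ edgesOf G (GainGraph.revWalk Q) := he'
    rw [edgesOf_revWalk] at this
    exact Set.disjoint_left.1 hd he this

theorem IsTheta.exists_paths {C : Set β} (h : IsTheta G C) {e : β} (he : e ∈ C) :
    ∃ (u v : V) (P Q R : List (OrientedEdge G)), u ≠ v ∧ IsPath G u P v ∧ IsPath G u R v ∧
      IsCycleAt G u (P ++ revWalk Q) ∧ e ∈ edgesOf G R ∧
      C = edgesOf G (P ++ revWalk Q) ∪ edgesOf G R ∧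
      Disjoint (edgesOf G (P ++ revWalk Q)) (edgesOf G R) ∧
      ∀ x ∈ incidentVertices G (edgesOf G (P ++ revWalk Q)), x ∈ u :: R.map OrientedEdge.tgt →
        x = u ∨ x = v := by
  obtain ⟨u, v, P, huv, hP, hd, hv, rfl⟩ := h
  obtain ⟨i, hi⟩ := Set.mem_iUnion.1 he
  obtain ⟨j, k, hij, hik, hjk, hall⟩ : ∃ j k : Fin 3, i ≠ j ∧ i ≠ k ∧ j ≠ k ∧
      ∀ l, l = i ∨ l = j ∨ l = k := by
    clear hi
    revert i; decide
  have hc : IsCycleAt G u (P j ++ revWalk (P k)) :=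
    (hP j).append_revWalk huv (hP k) (hd j k hjk) (hv j k hjk)
  refine ⟨u, v, P j, P k, P i, huv, hP j, hP i, hc, hi, ?_, ?_, ?_⟩
  · ext x
    rw [edgesOf_append, edgesOf_revWalk, Set.mem_iUnion]
    constructor
    · rintro ⟨l, hl⟩
      rcases hall l with rfl | rfl | rfl
      exacts [Or.inr hl, Or.inl (Or.inl hl), Or.inl (Or.inr hl)]
    · rintro ((hx | hx) | hx)
      exacts [⟨j, hx⟩, ⟨k, hx⟩, ⟨i, hx⟩]
  · rw [edgesOf_append, edgesOf_revWalk, Set.disjoint_union_left]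
    exact ⟨(hd i j hij).symm, (hd i k hik).symm⟩
  · rintro x ⟨f, hf, hx⟩ hxR
    rw [edgesOf_append, edgesOf_revWalk] at hf
    rcases hf with hf | hf
    · exact hv j i hij.symm x ((hP j).1.incidentVertices_subset ⟨f, hf, hx⟩) hxR
    · exact hv k i hik.symm x ((hP k).1.incidentVertices_subset ⟨f, hf, hx⟩) hxR

theorem IsTheta.nonempty {C : Set β} (h : IsTheta G C) : C.Nonempty := by
  obtain ⟨u, v, P, huv, hP, -, -, rfl⟩ := h
  have : P 0 ≠ [] := fun h0 => by
    have := (hP 0).1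
    rw [h0] at this
    exact huv this
  obtain ⟨d, W, hW⟩ := List.exists_cons_of_ne_nil this
  exact ⟨d.edge, Set.mem_iUnion.2 ⟨0, by simp [hW]⟩⟩

theorem IsPath.sdiff_singleton {u v : V} {A B : List (OrientedEdge G)} {d : OrientedEdge G}
    (h : IsPath G u (A ++ d :: B) v) :
    edgesOf G A ⊆ edgesOf G (A ++ d :: B) \ {d.edge} ∧
      edgesOf G B ⊆ edgesOf G (A ++ d :: B) \ {d.edge} := by
  have hn := h.edge_nodup
  rw [List.map_append, List.map_cons, List.nodup_append'] at hn
  constructor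
  · intro e he
    refine ⟨by rw [edgesOf_append]; exact Or.inl he, ?_⟩
    rintro rfl
    exact hn.2.2 he List.mem_cons_self
  · intro e he
    refine ⟨by rw [edgesOf_append, edgesOf_cons]; exact Or.inr (Or.inr he), ?_⟩
    rintro rfl
    exact (List.nodup_cons.1 hn.2.1).1 he

/-- Without `e`, the two parts of the path still connect its ends to the unbalanced vertices `u` and
`v`. -/
theorem IsPath.mem_frameCl {u v : V} {P : List (OrientedEdge G)} (h : IsPath G u P v) {X : Set β}
    {e : β} (he : e ∈ edgesOf G P) (hX : edgesOf G P \ {e} ⊆ X) (hu : Unb (Span ψ X) u)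
    (hv : Unb (Span ψ X) v) : e ∈ frameCl ψ X := by
  obtain ⟨d, hd, rfl⟩ := mem_edgesOf.1 he
  obtain ⟨A, B, rfl⟩ := List.append_of_mem hd
  obtain ⟨x, h1, h2⟩ := isWalk_append.1 h.1
  obtain ⟨rfl, h3⟩ := isWalk_cons.1 h2
  have hs := isGainRel_span ψ X
  exact mem_frameCl_of_unb
    (hs.unb_of_conn (hs.conn_symm (h1.conn (h.sdiff_singleton.1.trans hX))) hu)
    (hs.unb_of_conn (h3.conn (h.sdiff_singleton.2.trans hX)) hv)

/-- The two paths that avoid `e` form an unbalanced cycle through `u` and `v`, so the third path is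
spanned after deleting `e`. For independence, that cycle is extended from `v` along the third path
without its first edge. -/
theorem IsTheta.spec {C : Set β} (h : IsTheta G C)
    (hu : ∀ D ⊆ C, IsCycle G D → D ∉ ψ.balancedCycles) :
    (∀ e ∈ C, e ∈ frameCl ψ (C \ {e})) ∧ ∃ e ∈ C, ClIndep (frameCl ψ) (C \ {e}) := by
  constructor
  · intro e he
    obtain ⟨u, v, P, Q, R, huv, hP, hR, hc, heR, rfl, hd, -⟩ := h.exists_paths he
    have hcb := hu _ Set.subset_union_left hc.isCycle
    have hs : edgesOf G (P ++ revWalk Q) ⊆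
        (edgesOf G (P ++ revWalk Q) ∪ edgesOf G R) \ {e} := fun f hf =>
      ⟨Or.inl hf, fun hfe => Set.disjoint_left.1 hd hf (hfe ▸ heR)⟩
    have hv : v ∈ incidentVertices G (edgesOf G (P ++ revWalk Q)) := by
      have hPne : P ≠ [] := fun h0 => huv (by subst h0; exact hP.1)
      refine hc.mem_incidentVertices.2 ?_
      rw [List.map_append]
      exact List.mem_append_left _ (hP.1.end_mem_tgt hPne)
    exact hR.mem_frameCl heR (Set.sdiff_subset_sdiff_left Set.subset_union_right)
      (hc.isCycle.unb hcb hs hc.base_mem) (hc.isCycle.unb hcb hs hv)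
  · obtain ⟨e₀, he₀⟩ := h.nonempty
    obtain ⟨u, v, P, Q, R, huv, hP, hR, hc, -, rfl, -, hv⟩ := h.exists_paths he₀
    have hcb := hu _ Set.subset_union_left hc.isCycle
    have hRne : R ≠ [] := fun h0 => huv (by subst h0; exact hR.1)
    obtain ⟨d, R', rfl⟩ := List.exists_cons_of_ne_nil hRne
    obtain ⟨rfl, hu', hR'⟩ := IsPath.cons_iff.1 hR
    refine ⟨d.edge, Or.inr (by simp), ?_⟩
    have := clIndep_union_path (hc.isCycle.clIndep hcb) hR'.revWalk fun x hx hxC => ?_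
    · refine (isExchangeClosure_frameCl ψ).clIndep_subset this ?_
      rw [edgesOf_revWalk, edgesOf_cons]
      rintro f ⟨hf | hf, hfd⟩
      · exact Or.inl hf
      · exact Or.inr (hf.resolve_left hfd)
    · have hxR : x ∈ d.tgt :: R'.map OrientedEdge.tgt := by
        rw [← List.mem_reverse, ← hR'.1.map_tgt_revWalk]
        exact List.mem_cons_of_mem _ hx
      rcases hv x hxC (List.mem_cons_of_mem _ hxR) with rfl | rfl
      · exact hu' hxR
      · exact (List.nodup_cons.1 hR'.revWalk.2).1 hx

/-- A handcuff with cycles `D₁` and `D₂` and connecting path `P` from `u` to `v`; the path is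
trivial if the handcuff is tight. -/
structure IsHandcuffWith (G : Graph V β) (D₁ D₂ : Set β) (u v : V) (P : List (OrientedEdge G)) :
    Prop where
  cycle_left : IsCycle G D₁
  cycle_right : IsCycle G D₂
  path : IsPath G u P v
  disjoint : Disjoint D₁ D₂
  left_mem : u ∈ incidentVertices G D₁
  right_mem : v ∈ incidentVertices G D₂
  inter : ∀ x ∈ incidentVertices G D₁, x ∈ incidentVertices G D₂ → x = u ∧ x = v
  left : ∀ x ∈ u :: P.map OrientedEdge.tgt, x ∈ incidentVertices G D₁ → x = u
  right : ∀ x ∈ u :: P.map OrientedEdge.tgt, x ∈ incidentVertices G D₂ → x = v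

theorem IsHandcuffWith.swap {D₁ D₂ : Set β} {u v : V} {P : List (OrientedEdge G)}
    (h : IsHandcuffWith G D₁ D₂ u v P) : IsHandcuffWith G D₂ D₁ v u (revWalk P) where
  cycle_left := h.cycle_right
  cycle_right := h.cycle_left
  path := h.path.revWalk
  disjoint := h.disjoint.symm
  left_mem := h.right_mem
  right_mem := h.left_mem
  inter x hx hx' := (h.inter x hx' hx).symm
  left x hx := h.right x (by rwa [h.path.1.map_tgt_revWalk, List.mem_reverse] at hx)
  right x hx := h.left x (by rwa [h.path.1.map_tgt_revWalk, List.mem_reverse] at hx)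

theorem IsThetaOrHandcuff.cases {C : Set β} (h : IsThetaOrHandcuff G C) :
    IsTheta G C ∨ ∃ D₁ D₂ u v P, IsHandcuffWith G D₁ D₂ u v P ∧ C = D₁ ∪ D₂ ∪ edgesOf G P := by
  rcases h with h | ⟨D₁, D₂, h1, h2, hd, ⟨x, hx⟩, rfl⟩ |
    ⟨D₁, D₂, u, v, P, h1, h2, hd, hP, hv, rfl⟩
  · exact Or.inl h
  · have hx' : x ∈ incidentVertices G D₁ ∩ incidentVertices G D₂ := hx ▸ rfl
    have hu : ∀ y ∈ incidentVertices G D₁, y ∈ incidentVertices G D₂ → y = x :=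
      fun y h h' => by
        have : y ∈ incidentVertices G D₁ ∩ incidentVertices G D₂ := ⟨h, h'⟩
        rwa [hx] at this
    refine Or.inr ⟨D₁, D₂, x, x, [], ⟨h1, h2, ⟨rfl, by simp⟩, hd, hx'.1, hx'.2, fun y h h' =>
      ⟨hu y h h', hu y h h'⟩, ?_, ?_⟩, by simp⟩
    · intro y hy _; simpa using hy
    · intro y hy _; simpa using hy
  · refine Or.inr ⟨D₁, D₂, u, v, P, ⟨h1, h2, hP, ?_, ((hv u List.mem_cons_self).1).2 rfl,
      ((hv v hP.1.end_mem).2).2 rfl, fun x hx hx' => ?_, fun x hx => (hv x hx).1.1,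
      fun x hx => (hv x hx).2.1⟩, rfl⟩
    · rw [Set.disjoint_left]
      intro e he he'
      obtain ⟨x, y, hl⟩ := Graph.exists_isLink_of_mem_edgeSet (h1.subset_edgeSet he)
      exact Set.disjoint_left.1 hd ⟨e, he, hl.inc_left⟩ ⟨e, he', hl.inc_left⟩
    · exact (Set.disjoint_left.1 hd hx hx').elim

theorem IsHandcuffWith.disjoint_path {D₁ D₂ : Set β} {u v : V} {P : List (OrientedEdge G)}
    (h : IsHandcuffWith G D₁ D₂ u v P) : Disjoint D₁ (edgesOf G P) := by
  rw [Set.disjoint_left]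
  intro e he heP
  obtain ⟨d, hd, rfl⟩ := mem_edgesOf.1 heP
  obtain ⟨hs, ht⟩ := mem_incidentVertices_of_edge he
  refine h.path.src_ne_tgt hd ?_
  rw [h.left _ (h.path.1.src_mem hd) hs,
    h.left _ (List.mem_cons_of_mem _ (List.mem_map_of_mem hd)) ht]

theorem IsHandcuffWith.mem_frameCl {D₁ D₂ : Set β} {u v : V} {P : List (OrientedEdge G)}
    (h : IsHandcuffWith G D₁ D₂ u v P) (h2 : D₂ ∉ ψ.balancedCycles) {e : β} (he : e ∈ D₁) :
    e ∈ frameCl ψ ((D₁ ∪ D₂ ∪ edgesOf G P) \ {e}) := by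
  set X := (D₁ ∪ D₂ ∪ edgesOf G P) \ {e} with hX
  have hs := isGainRel_span ψ X
  have hD₂ : D₂ ⊆ X := fun f hf =>
    ⟨Or.inl (Or.inr hf), fun hfe => Set.disjoint_left.1 h.disjoint he (hfe ▸ hf)⟩
  have hPX : edgesOf G P ⊆ X := fun f hf =>
    ⟨Or.inr hf, fun hfe => Set.disjoint_left.1 h.disjoint_path he (hfe ▸ hf)⟩
  have hu : Unb (Span ψ X) u :=
    hs.unb_of_conn (h.path.1.conn hPX) (h.cycle_right.unb h2 hD₂ h.right_mem)
  -- The rest of the broken cycle still connects both ends of `e` to `u`, which is unbalanced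
  -- because of `D₂`.
  obtain ⟨d, Q, rfl, hc, hD⟩ := h.cycle_left.exists_cons he
  obtain ⟨-, hQ, hdQ⟩ := isCycleAt_cons.1 hc
  have hQX : edgesOf G Q ⊆ X := fun f hf =>
    ⟨Or.inl (Or.inl (hD ▸ by rw [edgesOf_cons]; exact Or.inr hf)), fun hfe => hdQ (hfe ▸ hf)⟩
  have huQ : u ∈ d.tgt :: Q.map OrientedEdge.tgt := by
    have := h.left_mem
    rw [← hD, hc.mem_incidentVertices] at this
    exact this
  obtain ⟨Q₁, Q₂, rfl, h3, h4⟩ := hQ.split huQ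
  rw [edgesOf_append, Set.union_subset_iff] at hQX
  exact mem_frameCl_of_unb (hs.unb_of_conn (hs.conn_symm (h4.1.conn hQX.2)) hu)
    (hs.unb_of_conn (h3.1.conn hQX.1) hu)

theorem IsHandcuffWith.spec {D₁ D₂ : Set β} {u v : V} {P : List (OrientedEdge G)}
    (h : IsHandcuffWith G D₁ D₂ u v P) (h1 : D₁ ∉ ψ.balancedCycles)
    (h2 : D₂ ∉ ψ.balancedCycles) :
    (∀ e ∈ D₁ ∪ D₂ ∪ edgesOf G P, e ∈ frameCl ψ ((D₁ ∪ D₂ ∪ edgesOf G P) \ {e})) ∧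
      ∃ e ∈ D₁ ∪ D₂ ∪ edgesOf G P,
        ClIndep (frameCl ψ) ((D₁ ∪ D₂ ∪ edgesOf G P) \ {e}) := by
  constructor
  · rintro e ((he | he) | he)
    · exact h.mem_frameCl h2 he
    · have := h.swap.mem_frameCl h1 he
      rwa [edgesOf_revWalk, Set.union_comm D₂ D₁] at this
    · have hd := h.swap.disjoint_path
      rw [edgesOf_revWalk] at hd
      refine h.path.mem_frameCl he (Set.sdiff_subset_sdiff_left Set.subset_union_right)
        (h.cycle_left.unb h1 ?_ h.left_mem) (h.cycle_right.unb h2 ?_ h.right_mem)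
      · exact fun f hf => ⟨Or.inl (Or.inl hf), fun hfe =>
          Set.disjoint_left.1 h.disjoint_path hf (hfe ▸ he)⟩
      · exact fun f hf => ⟨Or.inl (Or.inr hf), fun hfe =>
          Set.disjoint_left.1 hd hf (hfe ▸ he)⟩
  -- Grow the handcuff from `D₁` along the connecting path and then around `D₂`, leaving out the
  -- edge that would close `D₂`.
  · have hi := clIndep_union_path (h.cycle_left.clIndep h1) h.path fun x hx hxD =>
      (List.nodup_cons.1 h.path.2).1 (h.left x (List.mem_cons_of_mem _ hx) hxD ▸ hx)
    obtain ⟨W, hW, hWD⟩ := h.cycle_right.exists_isCycleAt h.right_mem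
    obtain ⟨d, Q, rfl⟩ := List.exists_cons_of_ne_nil hW.1
    obtain ⟨-, hQ, -⟩ := isCycleAt_cons.1 hW
    refine ⟨d.edge, Or.inl (Or.inr (hWD ▸ by simp)), ?_⟩
    have := clIndep_union_path hi hQ.revWalk fun x hx hxD => ?_
    · refine (isExchangeClosure_frameCl ψ).clIndep_subset this ?_
      rw [edgesOf_revWalk, ← hWD, edgesOf_cons]
      rintro f ⟨(hf | hf) | hf, hfd⟩
      · exact Or.inl (Or.inl hf)
      · exact Or.inr (hf.resolve_left hfd)
      · exact Or.inl (Or.inr hf)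
    · have hxv : x ≠ v := fun he => (List.nodup_cons.1 hQ.revWalk.2).1 (he ▸ hx)
      have hx2 : x ∈ incidentVertices G D₂ := by
        have := mem_incidentVertices_of_mem_tgt hx
        rw [edgesOf_revWalk] at this
        refine incidentVertices_mono ?_ this
        rw [← hWD, edgesOf_cons]
        exact Set.subset_insert _ _
      obtain ⟨f, hf | hf, hxf⟩ := hxD
      · exact hxv (h.inter x ⟨f, hf, hxf⟩ hx2).2
      · exact hxv (h.right x (h.path.1.incidentVertices_subset ⟨f, hf, hxf⟩) hx2)

theorem IsFrameCircuit.spec {C : Set β} (h : IsFrameCircuit G ψ.balancedCycles C) :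
    (∀ e ∈ C, e ∈ frameCl ψ (C \ {e})) ∧ ∃ e ∈ C, ClIndep (frameCl ψ) (C \ {e}) := by
  rcases h with h | ⟨h, hu⟩
  · exact balancedCycle_spec h
  · rcases h.cases with h' | ⟨D₁, D₂, u, v, P, h', rfl⟩
    · exact h'.spec hu
    · exact h'.spec (hu _ (Set.subset_union_left.trans Set.subset_union_left) h'.cycle_left)
        (hu _ (Set.subset_union_right.trans Set.subset_union_left) h'.cycle_right)

theorem IsThetaOrHandcuff.subset_edgeSet {C : Set β} (h : IsThetaOrHandcuff G C) : C ⊆ E(G) := by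
  rcases h.cases with ⟨u, v, P, -, -, -, -, rfl⟩ | ⟨D₁, D₂, u, v, P, h', rfl⟩
  · exact Set.iUnion_subset fun i => edgesOf_subset_edgeSet _
  · exact Set.union_subset (Set.union_subset h'.cycle_left.subset_edgeSet
      h'.cycle_right.subset_edgeSet) (edgesOf_subset_edgeSet _)

theorem isCycle_of_mem_balancedCycles {C : Set β} (h : C ∈ ψ.balancedCycles) : IsCycle G C :=
  let ⟨W, hW, hC, _⟩ := h; ⟨W, hW, hC⟩

theorem IsFrameCircuit.subset_edgeSet {C : Set β} (h : IsFrameCircuit G ψ.balancedCycles C) :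
    C ⊆ E(G) :=
  h.elim (fun h => (isCycle_of_mem_balancedCycles h).subset_edgeSet) fun h => h.1.subset_edgeSet

theorem exists_isFrameMatroid (hG : E(G).Finite) (ψ : GainFunction G Γ) :
    ∃ N : Matroid β, IsFrameMatroid ψ N ∧
      ∀ I, N.Indep I ↔ I ⊆ N.E ∧ ClIndep (frameCl ψ) I := by
  have hcl := isExchangeClosure_frameCl ψ
  obtain ⟨N, hE, hN⟩ := hcl.exists_matroid hG
  rw [← hE] at hN
  have hfc : ∀ C, IsFrameCircuit G ψ.balancedCycles C → N.IsCircuit C := fun C hC => by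
    obtain ⟨h1, e, he, hi⟩ := hC.spec
    exact hcl.isCircuit hN (hE ▸ hC.subset_edgeSet) (hG.subset hC.subset_edgeSet) h1 he hi
  refine ⟨N, ⟨hE, fun C => ⟨fun hC => ?_, hfc C⟩⟩, hN⟩
  -- Conversely, a circuit contains a frame circuit. This is itself a circuit, so the two are equal.
  obtain ⟨e, he, hecl⟩ := exists_mem_cl_of_isCircuit hN hC
  obtain ⟨C', hC', hfC'⟩ := exists_frameCircuit (hE ▸ hC.subset_ground he) (by simp) hecl
  rw [Set.insert_sdiff_singleton, Set.insert_eq_of_mem he] at hC'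
  rwa [← (hfc C' hfC').eq_of_subset_isCircuit hC hC']

end Independent

/-! ### Elementary lifts of matroids given by closure operators -/

section Lift

variable {β : Type*}

/-- A notion of balanced sets that behaves like the sets all of whose circuits are in a linear
class. -/
structure IsBalance (cl : Set β → Set β) (Bal : Set β → Prop) : Prop where
  empty : Bal ∅
  mono : ∀ {X Y}, Bal Y → X ⊆ Y → Bal X
  adjoin : ∀ {X e}, Bal X → e ∉ cl X → Bal (insert e X)
  extend : ∀ {X Z e}, Bal Z → X ⊆ Z → e ∈ cl X → Bal (insert e X) →
    Bal (insert e Z)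
  closed : ∀ {X}, Bal X → Bal {e | e ∈ cl X ∧ Bal (insert e X)}

/-- The closure operator of the elementary lift. -/
def liftCl (cl : Set β → Set β) (Bal : Set β → Prop) (X : Set β) : Set β :=
  {e | e ∈ cl X ∧ (Bal X → Bal (insert e X))}

namespace IsBalance

variable {cl : Set β → Set β} {Bal : Set β → Prop}

theorem bal_liftCl (hB : IsBalance cl Bal) {X : Set β} (hX : Bal X) : Bal (liftCl cl Bal X) :=
  hB.mono (hB.closed hX) fun _ he => ⟨he.1, he.2 hX⟩

/-- For unbalanced `X` nothing changes. For balanced `X`, `closed` and `extend` give idempotence. In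
the exchange, if adjoining `e` destroys balance, then `adjoin` puts `e` in `cl X`, and adjoining `f`
must destroy balance as well. -/
theorem isExchangeClosure (hB : IsBalance cl Bal) (h : IsExchangeClosure cl) :
    IsExchangeClosure (liftCl cl Bal) where
  subset_cl X e he := ⟨h.subset_cl X he, fun hX => by rwa [Set.insert_eq_of_mem he]⟩
  cl_subset {X Y} hXY e he := by
    refine ⟨h.cl_subset (fun f hf => (hXY hf).1) he.1, fun hY => ?_⟩
    have hZ := hB.bal_liftCl hY
    refine hB.mono (hB.extend hZ hXY he.1 (he.2 (hB.mono hZ hXY))) (Set.insert_subset_insert ?_)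
    exact fun f hf => ⟨h.subset_cl Y hf, fun _ => by rwa [Set.insert_eq_of_mem hf]⟩
  exchange {X e f} hf hfX := by
    by_cases hX : Bal X
    swap
    · refine ⟨h.exchange hf.1 fun hc => hfX ⟨hc, fun hb => absurd hb hX⟩, fun hb => ?_⟩
      exact absurd (hB.mono hb (Set.subset_insert _ _)) hX
    by_cases he : Bal (insert e X)
    · have hef := hf.2 he
      rw [Set.insert_comm] at hef
      have hfX' : f ∉ cl X := fun hc =>
        hfX ⟨hc, fun _ => hB.mono hef (Set.insert_subset_iff.2
          ⟨Set.mem_insert_of_mem _ (Set.mem_insert _ _), (Set.subset_insert _ _).trans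
            (Set.subset_insert _ _)⟩)⟩
      exact ⟨h.exchange hf.1 hfX', fun _ => hef⟩
    · have heX : e ∈ cl X := by
        by_contra hc
        exact he (hB.adjoin hX hc)
      have hcl : cl (insert e X) ⊆ cl X :=
        h.cl_subset (Set.insert_subset heX (h.subset_cl X))
      refine ⟨h.mono (Set.subset_insert _ _) heX, fun hb => absurd ⟨hcl hf.1, fun _ => hb⟩ hfX⟩

theorem bal_of_clIndep (hB : IsBalance cl Bal) (h : IsExchangeClosure cl) {I : Set β}
    (hfin : I.Finite) (hI : ClIndep cl I) : Bal I := by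
  induction I, hfin using Set.Finite.induction_on with
  | empty => exact hB.empty
  | @insert e I he _ ih =>
    refine hB.adjoin (ih (h.clIndep_subset hI (Set.subset_insert _ _))) fun hc => ?_
    refine hI e (Set.mem_insert _ _) ?_
    rwa [Set.insert_sdiff_self_of_notMem he]

theorem exists_lift (hB : IsBalance cl Bal) (h : IsExchangeClosure cl) {N : Matroid β}
    (hfin : N.E.Finite) (hN : ∀ I, N.Indep I ↔ I ⊆ N.E ∧ ClIndep cl I) :
    ∃ M : Matroid β, M.E = N.E ∧ ∀ X ⊆ N.E, (Bal X → M.eRk X = N.eRk X) ∧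
      (¬ Bal X → M.eRk X = N.eRk X + 1) := by
  have hL := hB.isExchangeClosure h
  obtain ⟨M, hE, hM⟩ := hL.exists_matroid hfin
  rw [← hE] at hM
  refine ⟨M, hE, fun X hX => ?_⟩
  obtain ⟨B, hBX⟩ := N.exists_isBasis X hX
  have hBi := (hN B).1 hBX.indep
  have hBfin := hfin.subset hBi.1
  have hbal : Bal B := hB.bal_of_clIndep h hBfin hBi.2
  have hXB : X ⊆ cl B := fun e he =>
    (h.mem_closure_iff hN hBX.indep (hX he)).1 (hBX.subset_closure he)
  have hBL : ClIndep (liftCl cl Bal) B := fun e he hc => hBi.2 e he hc.1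
  have key : ∀ B', ClIndep (liftCl cl Bal) B' → B' ⊆ X → X ⊆ liftCl cl Bal B' →
      M.eRk X = B'.encard := by
    intro B' hB' hB'X hXB'
    have hi : M.Indep B' := (hM B').2 ⟨hE ▸ hB'X.trans hX, hB'⟩
    refine (hi.isBasis_of_subset_of_subset_closure hB'X fun e he => ?_).eRk_eq_encard
    exact (hL.mem_closure_iff hM hi (hE ▸ hX he)).2 (hXB' he)
  refine ⟨fun hXb => ?_, fun hXb => ?_⟩
  · rw [hBX.eRk_eq_encard]
    exact key B hBL hBX.subset fun e he =>
      ⟨hXB he, fun _ => hB.mono hXb (Set.insert_subset he hBX.subset)⟩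
  -- A basis of an unbalanced set is balanced, so some element of the set unbalances it. Adjoining
  -- this element gives a basis in the lift.
  · have hns : ¬ X ⊆ liftCl cl Bal B := fun hs => hXb (hB.mono (hB.bal_liftCl hbal) hs)
    obtain ⟨e, heX, he⟩ := Set.not_subset.1 hns
    have heB : e ∉ B := fun hm => he (hL.subset_cl B hm)
    have hnb : ¬ Bal (insert e B) := fun hb => he ⟨hXB heX, fun _ => hb⟩
    rw [hBX.eRk_eq_encard, ← Set.encard_insert_of_notMem heB]
    exact key _ (hL.clIndep_insert hBL he) (Set.insert_subset heX hBX.subset) fun f hf =>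
      ⟨h.mono (Set.subset_insert _ _) (hXB hf), fun hb => absurd hb hnb⟩

end IsBalance

end Lift

/-! ### The lift matroid of a gain graph -/

section LiftMatroid

variable {V β Γ : Type*} [Group Γ] {G : Graph V β} {ψ : GainFunction G Γ}

theorem IsLiftBy.congr {N M : Matroid β} {𝒞 𝒟 : Set (Set β)}
    (h : ∀ C, N.IsCircuit C → (C ∈ 𝒞 ↔ C ∈ 𝒟)) : IsLiftBy N 𝒞 M ↔ IsLiftBy N 𝒟 M := by
  have : ∀ X, (∀ C ⊆ X, N.IsCircuit C → C ∈ 𝒞) ↔ ∀ C ⊆ X, N.IsCircuit C → C ∈ 𝒟 := fun X =>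
    forall₃_congr fun C _ hC => h C hC
  simp only [IsLiftBy, this]

theorem eq_of_eRk_eq {M M' : Matroid β} (hfin : M.E.Finite) (hE : M.E = M'.E)
    (h : ∀ X ⊆ M.E, M.eRk X = M'.eRk X) : M = M' :=
  Matroid.ext_indep hE fun I hI => by
    rw [Matroid.indep_iff_eRk_eq_encard_of_finite (hfin.subset hI),
      Matroid.indep_iff_eRk_eq_encard_of_finite (hfin.subset hI), h I hI]

theorem IsLiftBy.unique {N M M' : Matroid β} {𝒞 : Set (Set β)} (hfin : N.E.Finite)
    (h : IsLiftBy N 𝒞 M) (h' : IsLiftBy N 𝒞 M') : M = M' := by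
  refine eq_of_eRk_eq (h.1 ▸ hfin) (h.1.trans h'.1.symm) fun X hX => ?_
  rw [h.1] at hX
  by_cases hc : ∀ C ⊆ X, N.IsCircuit C → C ∈ 𝒞
  · rw [(h.2 X hX).1 hc, (h'.2 X hX).1 hc]
  · rw [(h.2 X hX).2 hc, (h'.2 X hX).2 hc]

theorem isLiftBy_iff_eq {N M : Matroid β} {𝒞 : Set (Set β)} (hfin : N.E.Finite)
    (h𝒞 : ∀ C, N.IsCircuit C → C ∈ 𝒞) : IsLiftBy N 𝒞 M ↔ M = N := by
  have hN : IsLiftBy N 𝒞 N :=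
    ⟨rfl, fun X _ => ⟨fun _ => rfl, fun hn => absurd (fun C _ hC => h𝒞 C hC) hn⟩⟩
  exact ⟨fun h => h.unique hfin hN, fun h => h ▸ hN⟩

theorem Span.conn_of_quotient {Γ₁ : Subgroup Γ} [Γ₁.Normal] (hΓ : Γ₁ = ⊤) {X : Set β} {u v : V}
    {k : Γ ⧸ Γ₁} (hk : Span (ψ.quotient Γ₁) X u v k) : Conn (Span ψ X) u v := by
  have : Subsingleton (Γ ⧸ Γ₁) := by rw [QuotientGroup.subsingleton_iff]; exact hΓ
  refine hk.least (R := fun u v _ => Conn (Span ψ X) u v) ⟨fun u => ⟨1, .refl u⟩,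
    (isGainRel_span ψ X).conn_symm, (isGainRel_span ψ X).conn_trans, ?_⟩
    fun d hd => ⟨_, .edge d hd⟩
  intro u v g _ _ _ hg
  exact absurd (Subsingleton.elim g 1) hg

/-- The set `X` admits a potential. -/
def HasPotential (ψ : GainFunction G Γ) (X : Set β) : Prop := ∃ η, IsPotential ψ η X

/-- The ends of `d` are connected within `X`, where both potentials are valid and hence prescribe
the same gain between them. -/
theorem IsPotential.extend {Γ₁ : Subgroup Γ} [Γ₁.Normal] (hΓ : Γ₁ = ⊤) {X Z : Set β}
    (hXZ : X ⊆ Z) {η : V → Γ} (hη : IsPotential ψ η Z) {d : OrientedEdge G}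
    (he : d.edge ∈ frameCl (ψ.quotient Γ₁) X) (hX : HasPotential ψ (insert d.edge X)) :
    ψ.gain d = (η d.src)⁻¹ * η d.tgt := by
  obtain ⟨ζ, hζ⟩ := hX
  obtain ⟨k, hk⟩ := (he d rfl).conn_of_quotient hΓ
  rw [hζ d (Set.mem_insert _ _), ← (hζ.mono (Set.subset_insert _ _)).span_eq hk,
    (hη.mono hXZ).span_eq hk]

theorem exists_orientedEdge {e : β} (he : e ∈ E(G)) : ∃ d : OrientedEdge G, d.edge = e :=
  let ⟨x, y, hl⟩ := Graph.exists_isLink_of_mem_edgeSet he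
  ⟨⟨e, x, y, hl⟩, rfl⟩

theorem IsPotential.insert_of_forall {X : Set β} {η : V → Γ} (hη : IsPotential ψ η X) {e : β}
    (h : ∀ d : OrientedEdge G, d.edge = e → ψ.gain d = (η d.src)⁻¹ * η d.tgt) :
    IsPotential ψ η (insert e X) := by
  rintro c (hc | hc)
  · exact h c hc
  · exact hη c hc

theorem HasPotential.adjoin {Γ₁ : Subgroup Γ} [Γ₁.Normal] (hΓ : Γ₁ = ⊤) {X : Set β}
    (hX : HasPotential ψ X) {d : OrientedEdge G} (hd : d.edge ∉ frameCl (ψ.quotient Γ₁) X) :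
    HasPotential ψ (insert d.edge X) := by
  classical
  have : Subsingleton (Γ ⧸ Γ₁) := by rw [QuotientGroup.subsingleton_iff]; exact hΓ
  obtain ⟨η, hη⟩ := hX
  let R := Span (ψ.quotient Γ₁) X
  have hR : IsGainRel R := isGainRel_span _ _
  have hn : ¬ Conn R d.src d.tgt := fun ⟨k, hk⟩ =>
    hd ((mem_frameCl_iff d).2 (by rwa [Subsingleton.elim ((ψ.quotient Γ₁).gain d) k]))
  -- Left multiplication by a constant on one component changes no gain inside it; the constant is
  -- chosen to fit `d`.
  refine ⟨fun v => if Conn R v d.tgt then η d.src * ψ.gain d * (η d.tgt)⁻¹ * η v else η v,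
    IsPotential.insert_edge (fun c hc => ?_) ?_⟩
  · have hcc : Conn R c.src c.tgt := ⟨_, .edge c hc⟩
    by_cases h : Conn R c.tgt d.tgt
    · rw [if_pos h, if_pos (hR.conn_trans hcc h), hη c hc]
      group
    · rw [if_neg h, if_neg fun h' => h (hR.conn_trans (hR.conn_symm hcc) h'), hη c hc]
  · rw [if_neg hn, if_pos ⟨1, .refl _⟩]
    group

theorem isBalance_hasPotential {Γ₁ : Subgroup Γ} [Γ₁.Normal] (hΓ : Γ₁ = ⊤)
    (ψ : GainFunction G Γ) : IsBalance (frameCl (ψ.quotient Γ₁)) (HasPotential ψ) where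
  empty := ⟨fun _ => 1, fun d hd => absurd hd (Set.notMem_empty _)⟩
  mono := fun ⟨η, hη⟩ hXY => ⟨η, hη.mono hXY⟩
  adjoin {X e} hX he := by
    by_cases hE : e ∈ E(G)
    · obtain ⟨d, rfl⟩ := exists_orientedEdge hE
      exact hX.adjoin hΓ he
    · exact absurd (fun d hd => absurd (hd ▸ d.isLink.edge_mem) hE) he
  extend := by
    rintro X Z e ⟨η, hη⟩ hXZ he hX
    refine ⟨η, hη.insert_of_forall ?_⟩
    rintro d rfl
    exact hη.extend hΓ hXZ he hX
  closed := by
    rintro X ⟨η, hη⟩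
    exact ⟨η, fun d hd => hη.extend hΓ subset_rfl hd.1 hd.2⟩

theorem IsPotential.balanced {η : V → Γ} {C : Set β} (hη : IsPotential ψ η C)
    (hC : IsCycle G C) : C ∈ ψ.balancedCycles := by
  obtain ⟨W, hW, rfl⟩ := hC
  obtain ⟨u, hu⟩ := isSimpleClosedWalk_iff.1 hW
  exact ⟨W, hW, rfl, by rw [hη.span_eq (hu.2.1.span subset_rfl), inv_mul_cancel]⟩

theorem IsPotential.insert_of_balanced {η : V → Γ} {B C : Set β} (hη : IsPotential ψ η B) {e : β}
    (hC : C ∈ ψ.balancedCycles) (he : e ∈ C) (hCB : C ⊆ insert e B) :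
    IsPotential ψ η (insert e B) := by
  obtain ⟨W, hW, rfl, hg⟩ := hC
  obtain ⟨u, hu⟩ := isSimpleClosedWalk_iff.1 hW
  obtain ⟨d, P, rfl, hc, hs, hg'⟩ := hu.exists_cons he ψ
  obtain ⟨-, hP, hd⟩ := isCycleAt_cons.1 hc
  have hPB : edgesOf G P ⊆ B := fun f hf =>
    (hCB (by rw [← hs, edgesOf_cons]; exact Or.inr hf)).resolve_left fun h => hd (h ▸ hf)
  refine hη.insert_edge ?_
  have h1 := hg'.2 hg
  rw [ψ.walkGain_cons, (hη.mono hPB).span_eq (hP.1.span subset_rfl)] at h1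
  rw [eq_inv_of_mul_eq_one_left h1]
  group

/-- A basis is independent and so has a potential; every other edge closes a balanced cycle with it
and therefore agrees with that potential. -/
theorem hasPotential_iff {Γ₁ : Subgroup Γ} [Γ₁.Normal] (hΓ : Γ₁ = ⊤) {N : Matroid β}
    (hfin : N.E.Finite) (hN : ∀ I, N.Indep I ↔ I ⊆ N.E ∧ ClIndep (frameCl (ψ.quotient Γ₁)) I)
    (hcyc : IsGraphicMatroid G N) {X : Set β} (hX : X ⊆ N.E) :
    (∀ C ⊆ X, N.IsCircuit C → C ∈ ψ.balancedCycles) ↔ HasPotential ψ X := by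
  constructor
  · intro h
    obtain ⟨B, hB⟩ := N.exists_isBasis X hX
    obtain ⟨η, hη⟩ := (isBalance_hasPotential hΓ ψ).bal_of_clIndep
      (isExchangeClosure_frameCl _) (hfin.subset hB.indep.subset_ground) ((hN B).1 hB.indep).2
    refine ⟨η, fun d hd => ?_⟩
    by_cases hdB : d.edge ∈ B
    · exact hη d hdB
    obtain ⟨C, hCB, hC, hdC⟩ :=
      Matroid.exists_isCircuit_of_mem_closure (hB.subset_closure hd) hdB
    exact hη.insert_of_balanced (h C (hCB.trans (Set.insert_subset hd hB.subset)) hC) hdC hCB d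
      (Set.mem_insert _ _)
  · rintro ⟨η, hη⟩ C hCX hC
    exact (hη.mono hCX).balanced ((hcyc.2 C).1 hC)

/-! ### The cases of trivial and full $\Gamma_1$. -/

theorem IsThetaOrHandcuff.exists_cycle {C : Set β} (h : IsThetaOrHandcuff G C) :
    ∃ D ⊂ C, IsCycle G D := by
  rcases h.cases with h' | ⟨D₁, D₂, u, v, P, h', rfl⟩
  · obtain ⟨e, he⟩ := h'.nonempty
    obtain ⟨u, v, P, Q, R, -, -, -, hc, heR, rfl, hd, -⟩ := h'.exists_paths he
    exact ⟨_, ⟨Set.subset_union_left, fun hs => Set.disjoint_left.1 hd (hs (Or.inr heR)) heR⟩,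
      hc.isCycle⟩
  · obtain ⟨e, he⟩ := h'.cycle_right.nonempty
    refine ⟨D₁, ⟨Set.subset_union_left.trans Set.subset_union_left, fun hs => ?_⟩, h'.cycle_left⟩
    exact Set.disjoint_left.1 h'.disjoint (hs (Or.inl (Or.inr he))) he

theorem mem_balancedCycles_of_subsingleton [Subsingleton Γ] {C : Set β} :
    C ∈ ψ.balancedCycles ↔ IsCycle G C :=
  ⟨isCycle_of_mem_balancedCycles, fun ⟨W, hW, hC⟩ => ⟨W, hW, hC, Subsingleton.elim _ _⟩⟩

theorem isFrameCircuit_iff_isCycle [Subsingleton Γ] {C : Set β} :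
    IsFrameCircuit G ψ.balancedCycles C ↔ IsCycle G C := by
  refine ⟨fun h => h.elim isCycle_of_mem_balancedCycles fun ⟨h, hu⟩ => ?_, fun h =>
    Or.inl (mem_balancedCycles_of_subsingleton.2 h)⟩
  obtain ⟨D, hD, hc⟩ := h.exists_cycle
  exact absurd (mem_balancedCycles_of_subsingleton.2 hc) (hu D hD.subset hc)

theorem isFrameMatroid_iff_isGraphicMatroid [Subsingleton Γ] {N : Matroid β} :
    IsFrameMatroid ψ N ↔ IsGraphicMatroid G N := by
  simp only [IsFrameMatroid, IsGraphicMatroid, isFrameCircuit_iff_isCycle]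

theorem IsFrameMatroid.unique {N N' : Matroid β} (h : IsFrameMatroid ψ N)
    (h' : IsFrameMatroid ψ N') : N = N' :=
  Matroid.ext_isCircuit (h.1.trans h'.1.symm) fun C _ => (h.2 C).trans (h'.2 C).symm

theorem balancedCycles_quotient_bot : (ψ.quotient ⊥).balancedCycles = ψ.balancedCycles := by
  have hg : ∀ W, (ψ.quotient ⊥).walkGain W = QuotientGroup.mk' ⊥ (ψ.walkGain W) := fun W => by
    rw [GainFunction.walkGain, GainFunction.walkGain, map_list_prod, List.map_map]
    rfl
  ext C
  refine exists_congr fun W => and_congr_right fun _ => and_congr_right fun _ => ?_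
  rw [hg, QuotientGroup.mk'_apply, QuotientGroup.eq_one_iff, Subgroup.mem_bot]

theorem isFrameMatroid_quotient_bot {N : Matroid β} :
    IsFrameMatroid (ψ.quotient ⊥) N ↔ IsFrameMatroid ψ N := by
  rw [IsFrameMatroid, IsFrameMatroid, balancedCycles_quotient_bot]

theorem isGainMatroid_bot_iff {𝒜 : Set (Subgroup Γ)} (h𝒜 : IsFrobeniusPartition ⊥ 𝒜)
    (hΓ : Finite Γ ∨ IsTrivialPartition ⊥ 𝒜) (hG : E(G).Finite) (M : Matroid β) :
    IsGainMatroid ⊥ 𝒜 ψ M ↔ IsFrameMatroid ψ M := by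
  have hlin : ∀ C, IsFrameCircuit G (ψ.quotient ⊥).balancedCycles C → C ∈ linearClass ⊥ 𝒜 ψ := by
    intro C hC
    refine ⟨hC, ?_⟩
    rw [balancedCycles_quotient_bot] at hC
    refine hC.imp id fun ⟨h, hu⟩ => ⟨h, fun _ => 1, ⊤, ?_, fun _ _ => Subgroup.mem_top _⟩
    -- Over the trivial group, `𝒜` may be empty, but all cycles are balanced and no theta graph or
    -- handcuff is a circuit.
    rcases subsingleton_or_nontrivial Γ with hs | hn
    · obtain ⟨D, hD, hc⟩ := h.exists_cycle
      exact absurd (mem_balancedCycles_of_subsingleton.2 hc) (hu D hD.subset hc)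
    · exact h𝒜.top_mem hΓ
  have hlift : ∀ {N : Matroid β}, IsFrameMatroid (ψ.quotient ⊥) N →
      (IsLiftBy N (linearClass ⊥ 𝒜 ψ) M ↔ M = N) := fun {N} hN =>
    isLiftBy_iff_eq (hN.1 ▸ hG) fun C hC => hlin C ((hN.2 C).1 hC)
  constructor
  · rintro ⟨N, hN, hM⟩
    rw [(hlift hN).1 hM]
    exact isFrameMatroid_quotient_bot.1 hN
  · intro hM
    have hM' := isFrameMatroid_quotient_bot.2 hM
    exact ⟨M, hM', (hlift hM').2 rfl⟩

theorem exists_isLiftMatroid (hG : E(G).Finite) (ψ : GainFunction G Γ) :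
    ∃ M : Matroid β, IsLiftMatroid ψ M := by
  have : Subsingleton (Γ ⧸ (⊤ : Subgroup Γ)) := by rw [QuotientGroup.subsingleton_iff]
  obtain ⟨N, hN, hi⟩ := exists_isFrameMatroid hG (ψ.quotient ⊤)
  have hcyc := isFrameMatroid_iff_isGraphicMatroid.1 hN
  have hfin : N.E.Finite := hN.1 ▸ hG
  obtain ⟨M, hE, hM⟩ := (isBalance_hasPotential rfl ψ).exists_lift
    (isExchangeClosure_frameCl _) hfin hi
  refine ⟨M, N, hcyc, hE, fun X hX => ?_⟩
  rw [hasPotential_iff rfl hfin hi hcyc hX]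
  exact hM X hX

theorem IsLiftMatroid.unique (hG : E(G).Finite) {M M' : Matroid β} (h : IsLiftMatroid ψ M)
    (h' : IsLiftMatroid ψ M') : M = M' := by
  obtain ⟨N, hN, hM⟩ := h
  obtain ⟨N', hN', hM'⟩ := h'
  obtain rfl : N = N' :=
    Matroid.ext_isCircuit (hN.1.trans hN'.1.symm) fun C _ => (hN.2 C).trans (hN'.2 C).symm
  exact hM.unique (hN.1 ▸ hG) hM'

theorem isGainMatroid_top_iff (𝒜 : Set (Subgroup Γ)) (M : Matroid β) :
    IsGainMatroid ⊤ 𝒜 ψ M ↔ IsLiftMatroid ψ M := by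
  have : Subsingleton (Γ ⧸ (⊤ : Subgroup Γ)) := by rw [QuotientGroup.subsingleton_iff]
  refine exists_congr fun N => ?_
  rw [isFrameMatroid_iff_isGraphicMatroid]
  refine and_congr_right fun hN => IsLiftBy.congr fun C hC => ?_
  have hcyc := (hN.2 C).1 hC
  refine ⟨fun h => h.2.resolve_right fun ⟨ht, _⟩ => ?_, fun h =>
    ⟨isFrameCircuit_iff_isCycle.2 hcyc, Or.inl h⟩⟩
  -- A theta graph or handcuff properly contains a cycle, which is a circuit, so it is not a circuit
  -- itself.
  obtain ⟨D, hD, hDc⟩ := ht.exists_cycle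
  exact hC.not_ssubset ((hN.2 D).2 hDc) hD

end LiftMatroid

end GainGraph

theorem mainTheorem6 {V β Γ : Type*} [Group Γ]
    (Γ₁ : Subgroup Γ) [Γ₁.Normal] (𝒜 : Set (Subgroup Γ))
    (h𝒜 : GainGraph.IsFrobeniusPartition Γ₁ 𝒜)
    (G : Graph V β) (hG : G.edgeSet.Finite) (ψ : GainGraph.GainFunction G Γ) :
    (Γ₁ = ⊥ → (Finite Γ ∨ GainGraph.IsTrivialPartition Γ₁ 𝒜) →
      (∃! M : Matroid β, GainGraph.IsGainMatroid Γ₁ 𝒜 ψ M) ∧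
      ∀ M : Matroid β, GainGraph.IsGainMatroid Γ₁ 𝒜 ψ M ↔ GainGraph.IsFrameMatroid ψ M) ∧
    (Γ₁ = ⊤ →
      (∃! M : Matroid β, GainGraph.IsGainMatroid Γ₁ 𝒜 ψ M) ∧
      ∀ M : Matroid β, GainGraph.IsGainMatroid Γ₁ 𝒜 ψ M ↔ GainGraph.IsLiftMatroid ψ M) := by
  constructor
  · rintro rfl hΓ
    have h := GainGraph.isGainMatroid_bot_iff (ψ := ψ) h𝒜 hΓ hG
    refine ⟨?_, h⟩
    obtain ⟨N, hN, -⟩ := GainGraph.exists_isFrameMatroid hG ψ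
    exact ⟨N, (h N).2 hN, fun M hM => ((h M).1 hM).unique hN⟩
  · rintro rfl
    have h := GainGraph.isGainMatroid_top_iff (ψ := ψ) 𝒜
    refine ⟨?_, h⟩
    obtain ⟨N, hN⟩ := GainGraph.exists_isLiftMatroid hG ψ
    exact ⟨N, (h N).2 hN, fun M hM => ((h M).1 hM).unique hG hN⟩
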